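/- Let $\nu,n,m,r\ge 0$ be integers, and let $A_\ell\in\mathbb R^{n\times n}$, $B_\ell\in\mathbb R^{n\times m}$, $C_\ell\in\mathbb R^{r\times n}$, $D_\ell\in\mathbb R^{r\times m}$, $G_\ell\in\mathbb R^{m\times r}$ ($\ell\in\mathbb Z^\nu$) be matrices with $$\sum_{\ell\in\mathbb Z^\nu}\left\|\begin{bmatrix}A_\ell&B_\ell\\ C_\ell&D_\ell\end{bmatrix}\right\|^2<\infty,\qquad \sum_{\ell\in\mathbb Z^\nu}\|G_\ell\|^2<\infty .$$ Let $\mathbb T=\mathbb R/2\pi\mathbb Z$, and let $\mathcal A(\sigma)=\sum_{\ell}e^{-i\ell^{\mathsf T}\sigma}A_\ell$ be the symbol of $(A_\ell)$, the series converging in $L^2(\mathbb T^\nu)$; define $\mathcal B,\mathcal C,\mathcal D,\mathcal G$ in the same way from $(B_\ell),(C_\ell),(D_\ell),(G_\ell)$. Assume that $$\operatorname*{ess\,sup}_{\sigma\in\mathbb T^\nu}\|\mathcal M(\sigma)\|<\infty\qquad\text{for each }\mathcal M\in\{\mathcal A,\mathcal B,\mathcal C,\mathcal D,\mathcal G\}$$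 ($\|\cdot\|$ being the operator norm), and that $\mathcal A(\sigma)$ is Hurwitz (all its eigenvalues have negative real parts) for almost every $\sigma\in\mathbb T^\nu$. Consider the network with state $x(t)\in\ell^2(\mathbb Z^\nu,\mathbb R^n)$, input $u(t)\in\ell^2(\mathbb Z^\nu,\mathbb R^m)$ and output $y(t)\in\ell^2(\mathbb Z^\nu,\mathbb R^r)$, started at $x(0)=0$ and governed for $t\ge 0$, $j\in\mathbb Z^\nu$ by $$\dot x_j=\sum_{k\in\mathbb Z^\nu}(A_{j-k}x_k+B_{j-k}u_k),\qquad y_j=\sum_{k\in\mathbb Z^\nu}(C_{j-k}x_k+D_{j-k}u_k),$$ where the differential equation is understood as the integral equation $x_j(t)=\int_0^t\sum_k(A_{j-k}x_k(\tau)+B_{j-k}u_k(\tau))\,d\tau$ with $x$ continuous in time. Then the following are equivalent. 1. The network is passive: for every input $u$ with $\int_0^T\sum_k|u_k(t)|^2\,dt<\infty$ for all $T>0$, one has $$\int_0^T\langle u(t),Gy(t)\rangle\,dt=\int_0^T\sum_{j\in\mathbb Z^\nu}u_j(t)^{\mathsf T}\sum_{k\in\mathbb Z^\nu}G_{j-k}\,y_k(t)\,dt\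 \ge\ 0\qquad\text{for all }T>0 .$$ 2. The spatio-temporal transfer function $F(s,\sigma)=\mathcal C(\sigma)(sI_n-\mathcal A(\sigma))^{-1}\mathcal B(\sigma)+\mathcal D(\sigma)$ satisfies $$F(i\omega,\sigma)^*\mathcal G(\sigma)^*+\mathcal G(\sigma)F(i\omega,\sigma)\succcurlyeq 0\qquad\text{for almost all }(\omega,\sigma)\in\mathbb R\times\mathbb T^\nu .$$ -/

import Mathlib

open MeasureTheory
open scoped Matrix.Norms.L2Operator ComplexOrder

noncomputable section

namespace LatticeNetwork

/-- The lattice `ℤ^ν`. -/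
abbrev Lattice (ν : ℕ) : Type := Fin ν → ℤ

instance factTwoPiPos : Fact (0 < 2 * Real.pi) := ⟨Real.two_pi_pos⟩

/-- The torus `𝕋^ν` with `𝕋 = ℝ / 2πℤ`; its `volume` has total mass `(2π)^ν`. -/
abbrev Torus (ν : ℕ) : Type := Fin ν → AddCircle (2 * Real.pi)

/-- The Hilbert space `L²(ℤ^ν, ℝ^p)` of square summable real vector-valued functions. -/
abbrev SqSum (ν p : ℕ) : Type := lp (fun _ : Lattice ν => EuclideanSpace ℝ (Fin p)) 2

/-! ### Symbols -/

/-- The function `σ ↦ exp (-i ℓᵀσ)` on the torus (see `character_coe`). -/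
def character {ν : ℕ} (ℓ : Lattice ν) : C(Torus ν, ℂ) where
  toFun σ := ∏ k, fourier (-ℓ k) (σ k)
  continuous_toFun := by fun_prop

theorem character_coe {ν : ℕ} (ℓ : Lattice ν) (σ : Fin ν → ℝ) :
    character ℓ (fun k => (σ k : AddCircle (2 * Real.pi))) =
      Complex.exp (-Complex.I * ∑ k, (ℓ k : ℂ) * (σ k : ℂ)) := by
  have hpi : (Real.pi : ℂ) ≠ 0 := by exact_mod_cast Real.pi_ne_zero
  simp only [character, ContinuousMap.coe_mk, fourier_coe_apply, Finset.mul_sum, Complex.exp_sum]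
  refine Finset.prod_congr rfl fun k _ => ?_
  congr 1
  push_cast
  field_simp

/-- The Fourier series `∑_ℓ exp (-i ℓᵀσ) M_ℓ`, entrywise the sum in `L²(𝕋^ν)`. For square
summable `M` the sum converges; as an element of `L²` it is determined up to a null set. -/
def symbol {ν p q : ℕ} (M : Lattice ν → Matrix (Fin p) (Fin q) ℝ) (σ : Torus ν) :
    Matrix (Fin p) (Fin q) ℂ :=
  Matrix.of fun i j =>
    (∑' ℓ, ((M ℓ i j : ℝ) : ℂ) •
      ContinuousMap.toLp 2 (volume : Measure (Torus ν)) ℂ (character ℓ) :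
        Lp ℂ 2 (volume : Measure (Torus ν))) σ

/-- Finiteness of the essential supremum over the torus of the operator norm of the symbol. -/
def BoundedSymbol {ν p q : ℕ} (M : Lattice ν → Matrix (Fin p) (Fin q) ℝ) : Prop :=
  essSup (fun σ : Torus ν => ‖symbol M σ‖ₑ) volume < ⊤

/-- A complex matrix is Hurwitz if all its eigenvalues have negative real parts. -/
def IsHurwitz {n : ℕ} (M : Matrix (Fin n) (Fin n) ℂ) : Prop :=
  ∀ s ∈ spectrum ℂ M, s.re < 0

/-- The spatio-temporal transfer function `F(s,σ) = 𝒞(σ) (s I - 𝒜(σ))⁻¹ ℬ(σ) + 𝒟(σ)`. -/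
def transferFunction {ν n m r : ℕ}
    (A : Lattice ν → Matrix (Fin n) (Fin n) ℝ) (B : Lattice ν → Matrix (Fin n) (Fin m) ℝ)
    (C : Lattice ν → Matrix (Fin r) (Fin n) ℝ) (D : Lattice ν → Matrix (Fin r) (Fin m) ℝ)
    (s : ℂ) (σ : Torus ν) : Matrix (Fin r) (Fin m) ℂ :=
  symbol C σ * (s • (1 : Matrix (Fin n) (Fin n) ℂ) - symbol A σ)⁻¹ * symbol B σ + symbol D σ

/-! ### Network dynamics -/

/-- The block Toeplitz matrix `(M_{j-k})` applied to a function on the lattice: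
`(M f)_j = ∑_k M_{j-k} f_k`. -/
def toeplitz {ν p q : ℕ} (M : Lattice ν → Matrix (Fin p) (Fin q) ℝ)
    (f : Lattice ν → EuclideanSpace ℝ (Fin q)) (j : Lattice ν) : EuclideanSpace ℝ (Fin p) :=
  ∑' k, Matrix.toEuclideanLin (M (j - k)) (f k)

/-- `x` and `y` are the state and the output of the network on `[0, ∞)` for the input `u`: the
state equation is read as a Volterra integral equation at each site of the lattice. -/
structure IsTrajectory {ν n m r : ℕ}
    (A : Lattice ν → Matrix (Fin n) (Fin n) ℝ) (B : Lattice ν → Matrix (Fin n) (Fin m) ℝ)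
    (C : Lattice ν → Matrix (Fin r) (Fin n) ℝ) (D : Lattice ν → Matrix (Fin r) (Fin m) ℝ)
    (u : ℝ → SqSum ν m) (x : ℝ → SqSum ν n) (y : ℝ → SqSum ν r) : Prop where
  continuousOn_state : ContinuousOn x (Set.Ici 0)
  state_eq : ∀ t : ℝ, 0 ≤ t → ∀ j : Lattice ν,
    x t j = x 0 j + ∫ τ in (0 : ℝ)..t, (toeplitz A (x τ) j + toeplitz B (u τ) j)
  output_eq : ∀ t : ℝ, 0 ≤ t → ∀ j : Lattice ν,
    y t j = toeplitz C (x t) j + toeplitz D (u t) j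

/-- Time-local square integrability: `∫₀ᵀ ‖u(t)‖₂² dt < ∞` for every `T > 0`. -/
def LocallySquareIntegrable {ν m : ℕ} (u : ℝ → SqSum ν m) : Prop :=
  ∀ T : ℝ, 0 < T → MemLp u 2 (volume.restrict (Set.Icc 0 T))

/-- The supply rate `⟨u, G y⟩ = ∑_j u_jᵀ ∑_k G_{j-k} y_k`. -/
def supplyRate {ν m r : ℕ} (G : Lattice ν → Matrix (Fin m) (Fin r) ℝ)
    (u : SqSum ν m) (y : SqSum ν r) : ℝ :=
  ∑' j, inner ℝ (u j) (toeplitz G y j)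

/-- Passivity: started at the zero state, every time-locally square integrable input performs
nonnegative work over every time interval `[0, T]`. -/
def IsPassive {ν n m r : ℕ}
    (A : Lattice ν → Matrix (Fin n) (Fin n) ℝ) (B : Lattice ν → Matrix (Fin n) (Fin m) ℝ)
    (C : Lattice ν → Matrix (Fin r) (Fin n) ℝ) (D : Lattice ν → Matrix (Fin r) (Fin m) ℝ)
    (G : Lattice ν → Matrix (Fin m) (Fin r) ℝ) : Prop :=
  ∀ u : ℝ → SqSum ν m, LocallySquareIntegrable u →
    ∀ (x : ℝ → SqSum ν n) (y : ℝ → SqSum ν r), IsTrajectory A B C D u x y → x 0 = 0 →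
      ∀ T : ℝ, 0 < T → 0 ≤ ∫ t in (0 : ℝ)..T, supplyRate G (u t) (y t)

end LatticeNetwork

end

open LatticeNetwork

namespace LatticeNetwork

open Set Filter Topology

/-! ### Operator exponentials -/

section Exponential

variable {𝔸 : Type*} [NormedRing 𝔸] [NormedAlgebra ℂ 𝔸] [CompleteSpace 𝔸]

/-! The Fourier transform turns block Toeplitz matrices into multiplication by their symbols on
L²(𝕋^ν), and by Parseval the supply rate becomes Re⟨U, 𝒢(𝒞X + 𝒟U)⟩ (`BoundedSymbol.toeplitz_reCoef`,
`IsTrajectory.supplyRate_eq`). Real signals are the functions with real Fourier coefficients. Since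
the symbols come from real matrices, a complex trajectory is a pair of real ones and its supply is
the sum of theirs, so passivity may be tested on complex inputs
(`IsPassive.integral_re_inner_nonneg`).

The core concerns bounded operators X' = aX + BU with output HX + JU, where ‖exp(τa)‖ ≤ 1/2 for some
τ > 0. Then iω - a is invertible for real ω. Suppose the frequency inequality holds. Continue the
input by zero from [0, T] to a long interval [0, L] and approximate it there by trigonometric
polynomials of period L. The response from rest is a periodic response minus a free evolution. The
periodic part does nonnegative work because distinct harmonics are orthogonal; the work of the free
part is bounded by a multiple of ‖X(L)‖, which tends to zero as L grows, since the input has stopped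
(`exists_response_trigPolynomial`, `supply_ge_of_frequency`, `supply_nonneg_of_frequency`).
Conversely, the work of a single harmonic input over [0, T] is T times the frequency form plus a
bounded transient, so the form cannot be negative (`frequency_nonneg_of_supply`).

Pointwise Hurwitz stability gives no uniform decay, so this theory does not apply to multiplication
by 𝒜 itself. By Gelfand's formula almost every σ eventually lies in the set where ‖exp(k𝒜(σ))‖ ≤
1/2. Replacing 𝒜 by -1 off this set gives a generator with a uniform contraction at time k, and
cut-offs to sets of frequencies commute with all multiplications. From frequency to passivity, cut
the trajectory off and let k tend to infinity by dominated convergence. From passivity to frequency,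
use inputs supported in the set; further cut-offs to arbitrary measurable sets make the integrated
inequality pointwise in σ, and continuity in (ω, v) extends it from a countable dense set. -/

theorem exp_add_smul (a : 𝔸) (s t : ℂ) :
    NormedSpace.exp ((s + t) • a) = NormedSpace.exp (s • a) * NormedSpace.exp (t • a) := by
  let : NormedAlgebra ℚ 𝔸 := NormedAlgebra.restrictScalars ℚ ℂ 𝔸
  rw [add_smul]
  exact NormedSpace.exp_add_of_commute (((Commute.refl a).smul_left s).smul_right t)

theorem exp_natCast_mul_smul (a : 𝔸) (s : ℂ) (k : ℕ) :
    NormedSpace.exp (((k : ℂ) * s) • a) = NormedSpace.exp (s • a) ^ k := by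
  induction k with
  | zero => simp
  | succ k ih => rw [Nat.cast_succ, add_mul, one_mul, exp_add_smul, ih, pow_succ]

theorem hasDerivAt_exp_ofReal_smul (a : 𝔸) (t : ℝ) :
    HasDerivAt (fun t : ℝ => NormedSpace.exp ((t : ℂ) • a))
      (a * NormedSpace.exp ((t : ℂ) • a)) t := by
  have h := (hasDerivAt_exp_smul_const' a (t : ℂ)).scomp t Complex.ofRealCLM.hasDerivAt
  simpa [Function.comp_def] using h

theorem continuous_exp_ofReal_smul (a : 𝔸) :
    Continuous fun t : ℝ => NormedSpace.exp ((t : ℂ) • a) :=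
  continuous_iff_continuousAt.2 fun t => (hasDerivAt_exp_ofReal_smul a t).continuousAt

end Exponential

/-! ### Bounded semigroups and the resolvent on the imaginary axis -/

section Semigroup

variable {K : Type*} [NormedAddCommGroup K] [NormedSpace ℂ K] [CompleteSpace K]

theorem hasDerivAt_exp_ofReal_smul_apply (a : K →L[ℂ] K) (z : K) (t : ℝ) :
    HasDerivAt (fun t : ℝ => NormedSpace.exp ((t : ℂ) • a) z)
      (a (NormedSpace.exp ((t : ℂ) • a) z)) t :=
  ((ContinuousLinearMap.apply ℂ K z).restrictScalars ℝ).hasFDerivAt.comp_hasDerivAt t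
    (hasDerivAt_exp_ofReal_smul a t)

/-- Split off the largest multiple of τ: the remaining time stays in the compact interval [0, τ],
and the powers of exp(τa) have norm at most 1. -/
theorem exists_norm_exp_smul_le (a : K →L[ℂ] K) {τ : ℝ} (hτ : 0 < τ)
    (h : ‖NormedSpace.exp ((τ : ℂ) • a)‖ ≤ 1 / 2) :
    ∃ M : ℝ, 0 ≤ M ∧ ∀ t : ℝ, 0 ≤ t → ‖NormedSpace.exp ((t : ℂ) • a)‖ ≤ M := by
  obtain ⟨M, hM⟩ := isCompact_Icc.exists_bound_of_continuousOn (s := Icc 0 τ)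
    (continuous_exp_ofReal_smul a).continuousOn
  have hM0 : 0 ≤ M := (norm_nonneg _).trans (hM 0 ⟨le_rfl, hτ.le⟩)
  refine ⟨M, hM0, fun t ht => ?_⟩
  obtain ⟨k, hk0, hk1⟩ : ∃ k : ℕ, (k : ℝ) * τ ≤ t ∧ t < (k + 1) * τ :=
    ⟨⌊t / τ⌋₊, (le_div_iff₀ hτ).1 (Nat.floor_le (by positivity)),
      (div_lt_iff₀ hτ).1 (Nat.lt_floor_add_one _)⟩
  have hpow : ‖NormedSpace.exp ((τ : ℂ) • a) ^ k‖ ≤ 1 := by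
    rcases Nat.eq_zero_or_pos k with rfl | hk
    · rw [pow_zero]
      exact ContinuousLinearMap.norm_id_le
    · exact (norm_pow_le' _ hk).trans (pow_le_one₀ (norm_nonneg _) (by linarith))
  have : (t : ℂ) = ((t - k * τ : ℝ) : ℂ) + (k : ℂ) * τ := by push_cast; ring
  rw [this, exp_add_smul a, exp_natCast_mul_smul a]
  refine (norm_mul_le _ _).trans ?_
  calc _ ≤ M * 1 := mul_le_mul (hM _ ⟨by linarith, by linarith⟩) hpow (norm_nonneg _) hM0
    _ = M := mul_one M

/-- If the semigroup generated by `a` is a strict contraction at some time, then the imaginary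
axis lies in the resolvent set of `a`. -/
theorem bijective_resolvent (a : K →L[ℂ] K) {τ : ℝ}
    (h : ‖NormedSpace.exp ((τ : ℂ) • a)‖ ≤ 1 / 2) (ω : ℝ) :
    Function.Bijective fun z : K => (Complex.I * ω) • z - a z := by
  rcases subsingleton_or_nontrivial K with hK | hK
  · exact ⟨fun _ _ _ => Subsingleton.elim _ _, fun b => ⟨0, Subsingleton.elim _ _⟩⟩
  -- Otherwise exp(iτω), of modulus 1, would lie in the spectrum of exp(τa), whose norm is at most
  -- 1/2.
  have hmem : (Complex.I * ω) ∉ spectrum ℂ a := by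
    intro hz
    have h1 : (τ : ℂ) * (Complex.I * ω) ∈ spectrum ℂ ((τ : ℂ) • a) := by
      have := spectrum.subset_polynomial_aeval a (Polynomial.C (τ : ℂ) * Polynomial.X)
        (Set.mem_image_of_mem _ hz)
      simpa [Algebra.smul_def] using this
    have h2 := spectrum.norm_le_norm_of_mem (spectrum.exp_mem_exp _ h1)
    rw [← Complex.exp_eq_exp_ℂ] at h2
    have h3 : (τ : ℂ) * (Complex.I * ω) = ((τ * ω : ℝ) : ℂ) * Complex.I := by push_cast; ring
    rw [h3, Complex.norm_exp_ofReal_mul_I] at h2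
    linarith
  obtain ⟨v, hv⟩ := spectrum.notMem_iff.1 hmem
  have hval : ∀ z, (Complex.I * ω) • z - a z = (v : K →L[ℂ] K) z := fun z => by
    simp [hv, Algebra.algebraMap_eq_smul_one]
  simp_rw [hval]
  refine Function.bijective_iff_has_inverse.2 ⟨(↑v⁻¹ : K →L[ℂ] K), fun z => ?_, fun z => ?_⟩
  · exact congrArg (fun f : K →L[ℂ] K => f z) v.inv_mul
  · exact congrArg (fun f : K →L[ℂ] K => f z) v.mul_inv

end Semigroup

/-! ### The Volterra equation `X t = ∫₀ᵗ (a X + f)` -/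

section Volterra

variable {K : Type*} [NormedAddCommGroup K] [NormedSpace ℂ K]

/-- `X` solves `X' = a X + f`, `X 0 = 0` on `[0, T]`, in integrated form. -/
structure SolvesState (a : K →L[ℂ] K) (f X : ℝ → K) (T : ℝ) : Prop where
  continuousOn : ContinuousOn X (Icc 0 T)
  integrableOn : IntegrableOn f (Ioc 0 T)
  eq_integral : ∀ t ∈ Icc 0 T, X t = ∫ τ in (0 : ℝ)..t, (a (X τ) + f τ)

namespace SolvesState

variable {a : K →L[ℂ] K} {f g X Y : ℝ → K} {T : ℝ}

theorem intervalIntegrable_state (h : SolvesState a f X T) {t : ℝ} (ht : t ∈ Icc 0 T) :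
    IntervalIntegrable (fun τ => a (X τ)) volume 0 t := by
  refine ContinuousOn.intervalIntegrable ?_
  rw [uIcc_of_le ht.1]
  exact a.continuous.comp_continuousOn (h.continuousOn.mono (Icc_subset_Icc_right ht.2))

theorem intervalIntegrable_input (h : SolvesState a f X T) {t : ℝ} (ht : t ∈ Icc 0 T) :
    IntervalIntegrable f volume 0 t :=
  (intervalIntegrable_iff_integrableOn_Ioc_of_le ht.1).2
    (h.integrableOn.mono_set (Ioc_subset_Ioc_right ht.2))

theorem sub (hX : SolvesState a f X T) (hY : SolvesState a g Y T) :
    SolvesState a (f - g) (X - Y) T where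
  continuousOn := hX.continuousOn.sub hY.continuousOn
  integrableOn := hX.integrableOn.sub hY.integrableOn
  eq_integral t ht := by
    rw [Pi.sub_apply, hX.eq_integral t ht, hY.eq_integral t ht, ← intervalIntegral.integral_sub
      ((hX.intervalIntegrable_state ht).add (hX.intervalIntegrable_input ht))
      ((hY.intervalIntegrable_state ht).add (hY.intervalIntegrable_input ht))]
    congr 1 with τ
    simp only [Pi.sub_apply, map_sub]
    abel

/-- Gronwall's inequality for solutions with an integrable inhomogeneity. -/
theorem norm_le [CompleteSpace K] (h : SolvesState a f X T) {t : ℝ} (ht : t ∈ Icc 0 T) :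
    ‖X t‖ ≤ Real.exp (‖a‖ * T) * ∫ τ in (0 : ℝ)..T, ‖f τ‖ := by
  have hT : 0 ≤ T := ht.1.trans ht.2
  set ε := ∫ τ in (0 : ℝ)..T, ‖f τ‖ with hε
  set V : ℝ → K := fun t => ∫ τ in (0 : ℝ)..t, f τ with hV
  have hVle : ∀ t ∈ Icc 0 T, ‖V t‖ ≤ ε := fun t ht => by
    refine (intervalIntegral.norm_integral_le_integral_norm ht.1).trans ?_
    exact intervalIntegral.integral_mono_interval le_rfl ht.1 ht.2
      (Eventually.of_forall fun _ => norm_nonneg _)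
      (h.intervalIntegrable_input ⟨hT, le_rfl⟩).norm
  have hZ : ∀ t ∈ Icc 0 T, X t = (∫ τ in (0 : ℝ)..t, a (X τ)) + V t := fun t ht => by
    rw [h.eq_integral t ht, intervalIntegral.integral_add (h.intervalIntegrable_state ht)
      (h.intervalIntegrable_input ht)]
  have hcont : ContinuousOn (fun τ => a (X τ)) (Icc 0 T) :=
    a.continuous.comp_continuousOn h.continuousOn
  have hε0 : 0 ≤ ε := (norm_nonneg _).trans (hVle t ht)
  -- `X` need not be differentiable, so Gronwall is applied to Z = ∫ aX, which starts at 0 and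
  -- satisfies Z' = a(Z + V) with ‖V‖ ≤ ε. Adding ‖V‖ ≤ ε back cancels the -ε in ε(exp(‖a‖t) - 1).
  have hbound := norm_le_gronwallBound_of_norm_deriv_right_le (a := 0) (b := T) (δ := 0)
    (K := ‖a‖) (ε := ‖a‖ * ε) (f := fun t => ∫ τ in (0 : ℝ)..t, a (X τ)) (f' := fun t => a (X t))
    ?_ ?_ (by simp) ?_ t ht
  · have h1 : ‖X t‖ ≤ gronwallBound 0 ‖a‖ (‖a‖ * ε) (t - 0) + ε := by
      rw [hZ t ht]
      exact (norm_add_le _ _).trans (add_le_add hbound (hVle t ht))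
    refine h1.trans ?_
    rcases eq_or_ne ‖a‖ 0 with ha | ha
    · simp [ha, gronwallBound_K0]
    · rw [gronwallBound_of_K_ne_0 ha]
      have : Real.exp (‖a‖ * (t - 0)) ≤ Real.exp (‖a‖ * T) := by
        rw [sub_zero]; gcongr; exact ht.2
      have h2 := mul_le_mul_of_nonneg_right this hε0
      field_simp
      linarith
  · have := intervalIntegral.continuousOn_primitive_interval (μ := volume) (a := 0) (b := T)
      (f := fun τ => a (X τ)) (by rw [uIcc_of_le hT]; exact hcont.integrableOn_Icc)
    rwa [uIcc_of_le hT] at this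
  · intro x hx
    have hIci : Icc x T ∈ 𝓝[≥] x := Icc_mem_nhdsGE hx.2
    have hx' : x ∈ Icc 0 T := ⟨hx.1, hx.2.le⟩
    have hcx : ContinuousWithinAt (fun τ => a (X τ)) (Ici x) x :=
      ((hcont x hx').mono (Icc_subset_Icc_left hx.1)).mono_of_mem_nhdsWithin hIci
    refine intervalIntegral.integral_hasDerivWithinAt_right (h.intervalIntegrable_state hx')
      (s := Ici x) (t := Ioi x) ?_ (hcx.mono Ioi_subset_Ici_self)
    refine ⟨Ioo x T, Ioo_mem_nhdsGT hx.2, ?_⟩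
    exact (hcont.mono (fun y hy => ⟨hx.1.trans hy.1.le, hy.2.le⟩)).aestronglyMeasurable
      measurableSet_Ioo
  · intro x hx
    have hx' : x ∈ Icc 0 T := ⟨hx.1, hx.2.le⟩
    refine (a.le_opNorm _).trans ?_
    rw [← mul_add]
    gcongr
    rw [hZ x hx']
    exact (norm_add_le _ _).trans (by gcongr; exact hVle x hx')

/-- Prolongation by the free evolution once the input vanishes. -/
theorem extend [CompleteSpace K] (h : SolvesState a f X T) {L : ℝ} (hT : 0 ≤ T) :
    SolvesState a ((Iic T).indicator f)
      (fun t => if t ≤ T then X t else NormedSpace.exp (((t - T : ℝ) : ℂ) • a) (X T)) L := by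
  have hle : ∀ t ≤ T, (fun t => if t ≤ T then X t else
      NormedSpace.exp (((t - T : ℝ) : ℂ) • a) (X T)) t = X t := fun t ht => if_pos ht
  have hge : ∀ t, T ≤ t → (fun t => if t ≤ T then X t else
      NormedSpace.exp (((t - T : ℝ) : ℂ) • a) (X T)) t =
        NormedSpace.exp (((t - T : ℝ) : ℂ) • a) (X T) := fun t ht => by
    rcases ht.eq_or_lt with rfl | ht
    · simp
    · exact if_neg ht.not_ge
  set X' := fun t => if t ≤ T then X t else NormedSpace.exp (((t - T : ℝ) : ℂ) • a) (X T)
  have hderiv : ∀ t, HasDerivAt (fun t : ℝ => NormedSpace.exp (((t - T : ℝ) : ℂ) • a) (X T))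
      (a (NormedSpace.exp (((t - T : ℝ) : ℂ) • a) (X T))) t := fun t => by
    simpa using (hasDerivAt_exp_ofReal_smul_apply a (X T) (t - T)).comp_sub_const t T
  have hcexp : Continuous (fun t : ℝ => NormedSpace.exp (((t - T : ℝ) : ℂ) • a) (X T)) :=
    continuous_iff_continuousAt.2 fun t => (hderiv t).continuousAt
  have hcont : ContinuousOn X' (Ici 0) := by
    have h1 : ContinuousOn X' (Icc 0 T) := h.continuousOn.congr fun t ht => hle t ht.2
    have h2 : ContinuousOn X' (Ici T) := hcexp.continuousOn.congr fun t ht => hge t ht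
    rw [← Icc_union_Ici_eq_Ici hT]
    exact h1.union_of_isClosed h2 isClosed_Icc isClosed_Ici
  have hInt : Integrable ((Iic T).indicator f) (volume.restrict (Ioi 0)) := by
    rw [integrable_indicator_iff measurableSet_Iic, IntegrableOn,
      Measure.restrict_restrict measurableSet_Iic, Iic_inter_Ioi]
    exact h.integrableOn
  refine ⟨hcont.mono Icc_subset_Ici_self,
    hInt.mono_measure (Measure.restrict_mono Ioc_subset_Ioi_self le_rfl), fun t ht => ?_⟩
  have hlow : ∀ t ∈ Icc 0 T, X' t = ∫ τ in (0 : ℝ)..t, (a (X' τ) + (Iic T).indicator f τ) := by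
    intro t ht
    rw [hle t ht.2, h.eq_integral t ht]
    refine intervalIntegral.integral_congr fun τ hτ => ?_
    rw [uIcc_of_le ht.1] at hτ
    have : τ ≤ T := hτ.2.trans ht.2
    simp only [hle τ this, indicator_of_mem (show τ ∈ Iic T from this)]
  rcases le_total t T with htT | htT
  · exact hlow t ⟨ht.1, htT⟩
  have hii : ∀ s s' : ℝ, 0 ≤ s → s ≤ s' → IntervalIntegrable
      (fun τ => a (X' τ) + (Iic T).indicator f τ) volume s s' := by
    intro s s' hs hss
    refine IntervalIntegrable.add (ContinuousOn.intervalIntegrable ?_) ?_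
    · rw [uIcc_of_le hss]
      exact a.continuous.comp_continuousOn (hcont.mono fun x hx => hs.trans hx.1)
    · refine (intervalIntegrable_iff_integrableOn_Ioc_of_le hss).2 ?_
      exact hInt.mono_measure (Measure.restrict_mono (fun x hx => hs.trans_lt hx.1) le_rfl)
  rw [← intervalIntegral.integral_add_adjacent_intervals (hii 0 T le_rfl hT) (hii T t hT htT),
    ← hlow T ⟨hT, le_rfl⟩, hge t htT, hle T le_rfl]
  -- The half-open interval `Ioc T t` omits the point T, where the indicator is still 1.
  have : ∫ τ in T..t, (a (X' τ) + (Iic T).indicator f τ) =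
      ∫ τ in T..t, a (NormedSpace.exp (((τ - T : ℝ) : ℂ) • a) (X T)) := by
    refine intervalIntegral.integral_congr_ae (Eventually.of_forall fun τ hτ => ?_)
    rw [uIoc_of_le htT] at hτ
    rw [hge τ hτ.1.le, indicator_of_notMem (by simpa using hτ.1), add_zero]
  rw [this, intervalIntegral.integral_eq_sub_of_hasDerivAt (fun τ _ => hderiv τ)
    ((a.continuous.comp hcexp).intervalIntegrable _ _)]
  simp

end SolvesState

/-- The response from rest to a periodic forcing is the difference of the stationary response and
a free evolution. -/
theorem solvesState_harmonic [CompleteSpace K] (a : K →L[ℂ] K) {ι : Type*} (s : Finset ι)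
    (ω : ι → ℝ) (z b : ι → K) (hz : ∀ j ∈ s, (Complex.I * ω j) • z j - a (z j) = b j) (T : ℝ) :
    SolvesState a (fun t => ∑ j ∈ s, Complex.exp (Complex.I * ω j * t) • b j)
      (fun t => ∑ j ∈ s, Complex.exp (Complex.I * ω j * t) • z j -
        NormedSpace.exp ((t : ℂ) • a) (∑ j ∈ s, z j)) T := by
  have hd : ∀ t : ℝ, HasDerivAt (fun t : ℝ => ∑ j ∈ s, Complex.exp (Complex.I * ω j * t) • z j -
      NormedSpace.exp ((t : ℂ) • a) (∑ j ∈ s, z j))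
      (∑ j ∈ s, (Complex.I * ω j * Complex.exp (Complex.I * ω j * t)) • z j -
        a (NormedSpace.exp ((t : ℂ) • a) (∑ j ∈ s, z j))) t := by
    intro t
    refine HasDerivAt.sub (HasDerivAt.fun_sum fun j _ => HasDerivAt.smul_const ?_ _)
      (hasDerivAt_exp_ofReal_smul_apply a _ t)
    have := ((hasDerivAt_id (t : ℂ)).const_mul (Complex.I * ω j)).cexp.comp_ofReal
    simpa [mul_comm] using this
  have hc := continuous_iff_continuousAt.2 fun t => (hd t).continuousAt
  have hf : Continuous fun t : ℝ => ∑ j ∈ s, Complex.exp (Complex.I * ω j * t) • b j := by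
    fun_prop
  refine ⟨hc.continuousOn, (hf.integrableOn_Icc).mono_set Ioc_subset_Icc_self, fun t _ => ?_⟩
  have heq : ∀ τ : ℝ, ∑ j ∈ s, (Complex.I * ω j * Complex.exp (Complex.I * ω j * τ)) • z j -
        a (NormedSpace.exp ((τ : ℂ) • a) (∑ j ∈ s, z j)) =
      a (∑ j ∈ s, Complex.exp (Complex.I * ω j * τ) • z j -
        NormedSpace.exp ((τ : ℂ) • a) (∑ j ∈ s, z j)) +
        ∑ j ∈ s, Complex.exp (Complex.I * ω j * τ) • b j := by
    intro τ
    rw [map_sub, sub_add_eq_add_sub, map_sum a, ← Finset.sum_add_distrib]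
    congr 1
    refine Finset.sum_congr rfl fun j hj => ?_
    rw [← hz j hj, smul_sub, smul_smul, map_smul, mul_comm]
    abel
  simp_rw [heq] at hd
  rw [intervalIntegral.integral_eq_sub_of_hasDerivAt (fun τ _ => hd τ)
    (((a.continuous.comp hc).add hf).intervalIntegrable _ _)]
  simp

end Volterra

/-! ### Density of vector-valued trigonometric polynomials -/

section Density

theorem span_fourier_toLp_closure_eq_top {L : ℝ} [Fact (0 < L)] :
    (Submodule.span ℂ (range fun j : ℤ =>
      ContinuousMap.toLp (E := ℂ) 2 (volume : Measure (AddCircle L)) ℂ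
        (fourier j))).topologicalClosure = ⊤ := by
  simpa only [Submodule.map_span, ContinuousLinearMap.coe_coe, ← range_comp, Function.comp_def]
    using (ContinuousMap.toLp_denseRange ℂ (volume : Measure (AddCircle L)) ℂ
      (by simp : (2 : ENNReal) ≠ ⊤)).topologicalClosure_map_submodule span_fourier_closure_eq_top

/-- The quotient map from (0, L] to the circle of length L preserves measure, so the density of
exponentials in L² of the circle can be pulled back. This is the scalar case from which the
vector-valued one is assembled. -/
theorem exists_trigPolynomial_eLpNorm_sub_indicator_le {L : ℝ} (hL : 0 < L) {S : Set ℝ}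
    (hS : MeasurableSet S) {ε : ENNReal} (hε : ε ≠ 0) :
    ∃ (s : Finset ℤ) (c : ℤ → ℂ), eLpNorm
      ((fun t : ℝ => ∑ j ∈ s, Complex.exp (Complex.I * (2 * Real.pi * j / L : ℝ) * t) * c j) -
        S.indicator fun _ => 1) 2 (volume.restrict (Ioc 0 L)) ≤ ε := by
  have : Fact (0 < L) := ⟨hL⟩
  let g : AddCircle L → ℂ := fun θ => S.indicator (fun _ => (1 : ℂ)) (AddCircle.equivIoc L 0 θ : ℝ)
  have hgm : Measurable g := (measurable_const.indicator hS).comp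
    (measurable_subtype_coe.comp (AddCircle.measurableEquivIoc L 0).measurable)
  have hg : MemLp g 2 (volume : Measure (AddCircle L)) := by
    refine MemLp.of_bound hgm.aestronglyMeasurable 1 (Eventually.of_forall fun θ => ?_)
    simp only [g, indicator]
    split_ifs <;> simp
  have hmem : hg.toLp g ∈ closure (Submodule.span ℂ (range fun j : ℤ =>
      ContinuousMap.toLp (E := ℂ) 2 (volume : Measure (AddCircle L)) ℂ (fourier j)) :
        Set (Lp ℂ 2 (volume : Measure (AddCircle L)))) := by
    rw [← Submodule.topologicalClosure_coe, span_fourier_toLp_closure_eq_top]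
    trivial
  obtain ⟨y, hy, hdist⟩ := EMetric.mem_closure_iff.1 hmem ε (pos_iff_ne_zero.2 hε)
  obtain ⟨c, rfl⟩ := Finsupp.mem_span_range_iff_exists_finsupp.1 hy
  refine ⟨c.support, c, ?_⟩
  have hmp := AddCircle.measurePreserving_mk L 0
  rw [zero_add] at hmp
  have hae : ((c.sum fun j r => r • ContinuousMap.toLp (E := ℂ) 2
      (volume : Measure (AddCircle L)) ℂ (fourier j) : Lp ℂ 2 (volume : Measure (AddCircle L))) :
        AddCircle L → ℂ) =ᵐ[volume] fun θ => ∑ j ∈ c.support, fourier j θ * c j := by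
    have h1 : (c.sum fun j r => r • ContinuousMap.toLp (E := ℂ) 2
      (volume : Measure (AddCircle L)) ℂ (fourier j)) =
        ContinuousMap.toLp (E := ℂ) 2 (volume : Measure (AddCircle L)) ℂ
          (∑ j ∈ c.support, c j • fourier j) := by
      simp [Finsupp.sum, map_sum]
    rw [h1]
    filter_upwards [ContinuousMap.coeFn_toLp (E := ℂ) (p := 2) (𝕜 := ℂ)
      (volume : Measure (AddCircle L)) (∑ j ∈ c.support, c j • fourier j)] with θ hθ
    rw [hθ]
    simp [mul_comm]
  have hnorm : eLpNorm ((fun θ => ∑ j ∈ c.support, fourier j θ * c j) - g) 2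
      (volume : Measure (AddCircle L)) ≤ ε := by
    rw [edist_comm, Lp.edist_def] at hdist
    refine (le_of_eq (eLpNorm_congr_ae ?_)).trans hdist.le
    exact hae.symm.sub hg.coeFn_toLp.symm
  have hmeas : AEStronglyMeasurable ((fun θ => ∑ j ∈ c.support, fourier j θ * c j) - g)
      (volume : Measure (AddCircle L)) := by
    refine AEStronglyMeasurable.sub ?_ hgm.aestronglyMeasurable
    exact Continuous.aestronglyMeasurable (by fun_prop)
  rw [← eLpNorm_comp_measurePreserving hmeas hmp] at hnorm
  refine (le_of_eq (eLpNorm_congr_ae ?_)).trans hnorm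
  filter_upwards [ae_restrict_mem measurableSet_Ioc] with t ht
  have ht' : (AddCircle.equivIoc L 0 (t : AddCircle L) : ℝ) = t := by
    have : t ∈ Ioc 0 (0 + L) := by simpa using ht
    rw [AddCircle.equivIoc_coe_of_mem this]
  simp only [Pi.sub_apply, Function.comp_apply, g]
  congr 1
  · refine Finset.sum_congr rfl fun j _ => ?_
    congr 1
    rw [fourier_coe_apply]
    congr 1
    push_cast
    ring
  · exact congrArg _ ht'.symm

/-- Trigonometric polynomials of period `L` with coefficients in `E` are dense in
`L²((0, L], E)`. -/
theorem exists_trigPolynomial_eLpNorm_sub_le {E : Type*} [NormedAddCommGroup E] [NormedSpace ℂ E]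
    {L : ℝ} (hL : 0 < L) {U : ℝ → E} (hU : MemLp U 2 (volume.restrict (Ioc 0 L)))
    {ε : ENNReal} (hε : ε ≠ 0) :
    ∃ (s : Finset ℤ) (W : ℤ → E), eLpNorm (U - fun t : ℝ =>
      ∑ j ∈ s, Complex.exp (Complex.I * (2 * Real.pi * j / L : ℝ) * t) • W j)
        2 (volume.restrict (Ioc 0 L)) ≤ ε := by
  -- Finitely supported coefficient functions make trigonometric polynomials visibly closed under
  -- addition, as density by induction from multiples of indicators requires.
  suffices h : ∃ g : ℝ → E, eLpNorm (U - g) 2 (volume.restrict (Ioc 0 L)) ≤ ε ∧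
      ∃ W : ℤ →₀ E, g = fun t : ℝ =>
        W.sum fun j w => Complex.exp (Complex.I * (2 * Real.pi * j / L : ℝ) * t) • w by
    obtain ⟨g, hg, W, rfl⟩ := h
    exact ⟨W.support, W, hg⟩
  refine MemLp.induction_dense (by simp)
    (fun g : ℝ → E => ∃ (W : ℤ →₀ E), g = fun t : ℝ =>
      W.sum fun j w => Complex.exp (Complex.I * (2 * Real.pi * j / L : ℝ) * t) • w)
    ?_ ?_ ?_ hU hε
  · intro w S hS _ ε hε
    -- Essentially δ = ε / ‖w‖; the cases ε = ⊤ and w = 0 are set apart, and any nonzero δ serves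
    -- there.
    obtain ⟨δ, hδ, hδε⟩ : ∃ δ : ENNReal, δ ≠ 0 ∧ ‖w‖ₑ * δ ≤ ε := by
      rcases eq_or_ne ε ⊤ with rfl | hε'
      · exact ⟨1, one_ne_zero, le_top⟩
      rcases eq_or_ne w 0 with rfl | hw
      · exact ⟨1, one_ne_zero, by simp⟩
      · have hw0 : ‖w‖ₑ ≠ 0 := by simpa using hw
        exact ⟨ε / ‖w‖ₑ, ENNReal.div_ne_zero.2 ⟨hε, enorm_ne_top⟩,
          (ENNReal.mul_div_cancel hw0 enorm_ne_top).le⟩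
    obtain ⟨s, c, hsc⟩ := exists_trigPolynomial_eLpNorm_sub_indicator_le hL hS hδ
    refine ⟨_, ?_, Finsupp.onFinset s (fun j => if j ∈ s then c j • w else 0)
      (fun j hj => by by_contra h; simp [h] at hj), rfl⟩
    refine le_trans ?_ (hδε.trans' (mul_le_mul_right hsc _))
    refine le_of_eq_of_le (eLpNorm_congr_norm_ae (g := fun t => ‖w‖ *
      ‖(fun t : ℝ => ∑ j ∈ s, Complex.exp (Complex.I * (2 * Real.pi * j / L : ℝ) * t) * c j) t -
        S.indicator (fun _ => 1) t‖) (Eventually.of_forall fun t => ?_)) ?_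
    · rw [norm_mul, norm_norm, norm_norm, mul_comm ‖w‖, ← norm_smul]
      congr 1
      rw [Pi.sub_apply, sub_smul, Finset.sum_smul,
        Finsupp.onFinset_sum _ (by simp)]
      congr 1
      · refine Finset.sum_congr rfl fun j hj => ?_
        rw [if_pos hj, smul_smul]
      · by_cases ht : t ∈ S <;> simp [ht]
    · refine (eLpNorm_const_smul_le (c := ‖w‖) (p := 2)).trans ?_
      rw [enorm_norm, eLpNorm_norm]
      rfl
  · rintro _ _ ⟨V, rfl⟩ ⟨W, rfl⟩
    refine ⟨V + W, ?_⟩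
    ext t
    rw [Finsupp.sum_add_index' (by simp) (by simp)]
    rfl
  · rintro _ ⟨W, rfl⟩
    refine Continuous.aestronglyMeasurable ?_
    simp only [Finsupp.sum]
    fun_prop

end Density

/-! ### Passivity and the frequency inequality for bounded operators -/

theorem integral_exp_sub_eq_ite {L : ℝ} (hL : 0 < L) (j k : ℤ) :
    ∫ t in (0 : ℝ)..L, (starRingEnd ℂ) (Complex.exp (Complex.I * (2 * Real.pi * j / L : ℝ) * t)) *
      Complex.exp (Complex.I * (2 * Real.pi * k / L : ℝ) * t) = if j = k then (L : ℂ) else 0 := by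
  have h : ∀ t : ℝ, (starRingEnd ℂ) (Complex.exp (Complex.I * (2 * Real.pi * j / L : ℝ) * t)) *
      Complex.exp (Complex.I * (2 * Real.pi * k / L : ℝ) * t) =
        Complex.exp (Complex.I * (2 * Real.pi * (k - j) / L : ℝ) * t) := fun t => by
    rw [← Complex.exp_conj, ← Complex.exp_add]
    congr 1
    simp only [map_mul, Complex.conj_I, Complex.conj_ofReal]
    push_cast
    ring
  simp_rw [h]
  split_ifs with hjk
  · simp [hjk]
  · have hc : Complex.I * (2 * Real.pi * (k - j) / L : ℝ) ≠ 0 := by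
      refine mul_ne_zero Complex.I_ne_zero (Complex.ofReal_ne_zero.2 ?_)
      have : (k - j : ℝ) ≠ 0 := sub_ne_zero.2 (by exact_mod_cast Ne.symm hjk)
      positivity
    rw [integral_exp_mul_complex hc]
    have h1 : Complex.I * (2 * Real.pi * (k - j) / L : ℝ) * L =
        ((k - j : ℤ) : ℂ) * (2 * Real.pi * Complex.I) := by
      have : (L : ℂ) ≠ 0 := by exact_mod_cast hL.ne'
      push_cast
      field_simp
    rw [h1, Complex.exp_int_mul_two_pi_mul_I]
    simp

/-- Distinct harmonics are orthogonal over a full period, so only the diagonal terms survive: work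
decouples frequency by frequency. -/
theorem integral_inner_trigPolynomial {E : Type*} [NormedAddCommGroup E] [InnerProductSpace ℂ E]
    {L : ℝ} (hL : 0 < L) (s : Finset ℤ) (V W : ℤ → E) :
    ∫ t in (0 : ℝ)..L, inner ℂ
      (∑ j ∈ s, Complex.exp (Complex.I * (2 * Real.pi * j / L : ℝ) * t) • V j)
      (∑ j ∈ s, Complex.exp (Complex.I * (2 * Real.pi * j / L : ℝ) * t) • W j) =
        L * ∑ j ∈ s, inner ℂ (V j) (W j) := by
  simp only [sum_inner, inner_sum, inner_smul_left, inner_smul_right, Finset.mul_sum]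
  rw [intervalIntegral.integral_finsetSum fun j _ => Continuous.intervalIntegrable
    (by fun_prop) _ _]
  refine Finset.sum_congr rfl fun j hj => ?_
  rw [intervalIntegral.integral_finsetSum fun j _ => Continuous.intervalIntegrable
    (by fun_prop) _ _]
  simp only [← mul_assoc, intervalIntegral.integral_mul_const,
    mul_comm (Complex.exp _) ((starRingEnd ℂ) _), integral_exp_sub_eq_ite hL]
  simp [hj]

section Frequency

variable {K E : Type*} [NormedAddCommGroup K] [NormedSpace ℂ K]
  [NormedAddCommGroup E] [InnerProductSpace ℂ E]

variable {a : K →L[ℂ] K} {B : E →L[ℂ] K} {H : K →L[ℂ] E} {J : E →L[ℂ] E}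

theorem SolvesState.memLp {f X : ℝ → K} {L : ℝ} (h : SolvesState a f X L) :
    MemLp X 2 (volume.restrict (Ioc 0 L)) := by
  obtain ⟨c, hc⟩ := isCompact_Icc.exists_bound_of_continuousOn h.continuousOn
  refine MemLp.of_bound ((h.continuousOn.mono Ioc_subset_Icc_self).aestronglyMeasurable
    measurableSet_Ioc) c ?_
  filter_upwards [ae_restrict_mem measurableSet_Ioc] with t ht
  exact hc t (Ioc_subset_Icc_self ht)

/-- As an inner product in L²((0, L]), the work is continuous in the pair (U, X), which lets it pass
to the limit. -/
theorem intervalIntegral_re_inner_eq {U : ℝ → E} {X : ℝ → K} {L : ℝ} (hL : 0 ≤ L)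
    (hU : MemLp U 2 (volume.restrict (Ioc 0 L))) (hX : MemLp X 2 (volume.restrict (Ioc 0 L))) :
    ∫ t in (0 : ℝ)..L, (inner ℂ (U t) (H (X t) + J (U t))).re =
      (inner ℂ (hU.toLp U) (H.compLp (hX.toLp X) + J.compLp (hU.toLp U))).re := by
  rw [L2.inner_def, ← RCLike.re_eq_complex_re, ← integral_re (L2.integrable_inner _ _),
    intervalIntegral.integral_of_le hL]
  refine integral_congr_ae ?_
  filter_upwards [hU.coeFn_toLp, hX.coeFn_toLp, Lp.coeFn_add (H.compLp (hX.toLp X))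
    (J.compLp (hU.toLp U)), H.coeFn_compLp (hX.toLp X), J.coeFn_compLp (hU.toLp U)]
    with t h1 h2 h3 h4 h5
  rw [h3, Pi.add_apply, h4, h5, h1, h2]

variable [CompleteSpace K]

/-- Solve iω z_j - a z_j = B W_j at each frequency ω = 2πj/L. The response from rest is the periodic
sum of the harmonics z_j minus the free evolution of z₀ = ∑ z_j. The periodic part does nonnegative
work by `hpos` and orthogonality; the free part costs at most ‖H‖ M ‖z₀‖ ∫‖U‖. At time L the
periodic part is back at z₀, so X(L) = z₀ - exp(La) z₀ and ‖z₀‖ ≤ 2‖X(L)‖. The bound is phrased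
through X(L) because, unlike z₀, it makes sense for arbitrary inputs and is continuous in them. -/
theorem exists_response_trigPolynomial {L M : ℝ} (hL : 0 < L)
    (hexp : ‖NormedSpace.exp ((L : ℂ) • a)‖ ≤ 1 / 2)
    (hM : ∀ t : ℝ, 0 ≤ t → ‖NormedSpace.exp ((t : ℂ) • a)‖ ≤ M)
    (hpos : ∀ (ω : ℝ) (z : K) (w : E), (Complex.I * ω) • z - a z = B w →
      0 ≤ (inner ℂ w (H z + J w)).re) (s : Finset ℤ) (W : ℤ → E) {U : ℝ → E}
    (hU : U = fun t : ℝ =>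
      ∑ j ∈ s, Complex.exp (Complex.I * (2 * Real.pi * j / L : ℝ) * t) • W j) :
    ∃ X : ℝ → K, SolvesState a (fun t => B (U t)) X L ∧
      -(2 * ‖H‖ * M * ‖X L‖ * ∫ t in (0 : ℝ)..L, ‖U t‖) ≤
        ∫ t in (0 : ℝ)..L, (inner ℂ (U t) (H (X t) + J (U t))).re := by
  have hM0 : 0 ≤ M := (norm_nonneg _).trans (hM 0 le_rfl)
  choose z hz using fun j : ℤ => (bijective_resolvent a hexp (2 * Real.pi * j / L)).2 (B (W j))
  simp only at hz
  have hsol := solvesState_harmonic a s (fun j : ℤ => 2 * Real.pi * j / L) z (fun j => B (W j))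
    (fun j _ => hz j) L
  have hBU : (fun t => B (U t)) = fun t : ℝ =>
      ∑ j ∈ s, Complex.exp (Complex.I * (2 * Real.pi * j / L : ℝ) * t) • B (W j) := by
    ext t; simp [hU]
  refine ⟨_, hBU ▸ hsol, ?_⟩
  set z₀ := ∑ j ∈ s, z j with hz₀
  have hUc : Continuous U := by rw [hU]; fun_prop
  have hec : Continuous fun t : ℝ => NormedSpace.exp ((t : ℂ) • a) z₀ :=
    continuous_iff_continuousAt.2 fun t => (hasDerivAt_exp_ofReal_smul_apply a z₀ t).continuousAt
  have hXL : ‖z₀‖ ≤ 2 * ‖∑ j ∈ s, Complex.exp (Complex.I * (2 * Real.pi * j / L : ℝ) * L) • z j -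
      NormedSpace.exp ((L : ℂ) • a) z₀‖ := by
    have h1 : ∑ j ∈ s, Complex.exp (Complex.I * (2 * Real.pi * j / L : ℝ) * L) • z j = z₀ := by
      refine Finset.sum_congr rfl fun j _ => ?_
      have h1 : Complex.I * (2 * Real.pi * j / L : ℝ) * L =
          (j : ℂ) * (2 * Real.pi * Complex.I) := by
        have : (L : ℂ) ≠ 0 := by exact_mod_cast hL.ne'
        push_cast
        field_simp
      rw [h1, Complex.exp_int_mul_two_pi_mul_I, one_smul]
    rw [h1]
    have h2 := norm_sub_norm_le z₀ (NormedSpace.exp ((L : ℂ) • a) z₀)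
    have h3 := (NormedSpace.exp ((L : ℂ) • a)).le_of_opNorm_le hexp z₀
    linarith
  have hsplit : ∀ t : ℝ, (inner ℂ (U t)
      (H (∑ j ∈ s, Complex.exp (Complex.I * (2 * Real.pi * j / L : ℝ) * t) • z j -
        NormedSpace.exp ((t : ℂ) • a) z₀) + J (U t))).re =
      (inner ℂ (U t) (∑ j ∈ s, Complex.exp (Complex.I * (2 * Real.pi * j / L : ℝ) * t) •
        (H (z j) + J (W j)))).re - (inner ℂ (U t) (H (NormedSpace.exp ((t : ℂ) • a) z₀))).re := by
    intro t
    rw [← Complex.sub_re, ← inner_sub_right]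
    congr 2
    simp only [hU, map_sub, map_sum, map_smul, smul_add, Finset.sum_add_distrib]
    abel
  simp_rw [hsplit]
  rw [intervalIntegral.integral_sub (Continuous.intervalIntegrable (by fun_prop) _ _)
    (Continuous.intervalIntegrable (by fun_prop) _ _)]
  have hmain : 0 ≤ ∫ t in (0 : ℝ)..L, (inner ℂ (U t)
      (∑ j ∈ s, Complex.exp (Complex.I * (2 * Real.pi * j / L : ℝ) * t) •
        (H (z j) + J (W j)))).re := by
    have h1 := Complex.reCLM.intervalIntegral_comp_comm (a := 0) (b := L) (μ := volume)
      (f := fun t : ℝ => inner ℂ (U t)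
      (∑ j ∈ s, Complex.exp (Complex.I * (2 * Real.pi * j / L : ℝ) * t) • (H (z j) + J (W j))))
      (Continuous.intervalIntegrable (by fun_prop) _ _)
    simp only [Complex.reCLM_apply] at h1
    rw [h1, hU, integral_inner_trigPolynomial hL, Complex.re_ofReal_mul, Complex.re_sum]
    exact mul_nonneg hL.le (Finset.sum_nonneg fun j _ => hpos _ _ _ (hz j))
  have herr : ∫ t in (0 : ℝ)..L, (inner ℂ (U t) (H (NormedSpace.exp ((t : ℂ) • a) z₀))).re ≤
      ∫ t in (0 : ℝ)..L, ‖H‖ * M * ‖z₀‖ * ‖U t‖ := by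
    refine intervalIntegral.integral_mono_on hL.le (Continuous.intervalIntegrable (by fun_prop) _ _)
      (Continuous.intervalIntegrable (by fun_prop) _ _) fun t ht => ?_
    refine (Complex.re_le_norm _).trans ((norm_inner_le_norm _ _).trans ?_)
    rw [mul_comm]
    gcongr
    refine (H.le_opNorm _).trans ?_
    rw [mul_assoc]
    gcongr
    exact ContinuousLinearMap.le_of_opNorm_le _ (hM t ht.1) _
  rw [intervalIntegral.integral_const_mul] at herr
  have hUn : 0 ≤ ∫ t in (0 : ℝ)..L, ‖U t‖ :=
    intervalIntegral.integral_nonneg hL.le fun _ _ => norm_nonneg _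
  have hfin := mul_le_mul_of_nonneg_right
    (mul_le_mul_of_nonneg_left hXL (mul_nonneg (norm_nonneg H) hM0)) hUn
  linarith

/-- Both sides of the inequality for trigonometric polynomials are continuous in the input. On a
bounded interval L² convergence implies L¹ convergence, and Gronwall's inequality turns the latter
into uniform convergence of the states. -/
theorem supply_ge_of_frequency {L M : ℝ} (hL : 0 < L)
    (hexp : ‖NormedSpace.exp ((L : ℂ) • a)‖ ≤ 1 / 2)
    (hM : ∀ t : ℝ, 0 ≤ t → ‖NormedSpace.exp ((t : ℂ) • a)‖ ≤ M)
    (hpos : ∀ (ω : ℝ) (z : K) (w : E), (Complex.I * ω) • z - a z = B w →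
      0 ≤ (inner ℂ w (H z + J w)).re) {U : ℝ → E} {X : ℝ → K}
    (hU : MemLp U 2 (volume.restrict (Ioc 0 L))) (hX : SolvesState a (fun t => B (U t)) X L) :
    -(2 * ‖H‖ * M * ‖X L‖ * ∫ t in (0 : ℝ)..L, ‖U t‖) ≤
        ∫ t in (0 : ℝ)..L, (inner ℂ (U t) (H (X t) + J (U t))).re := by
  set μ := volume.restrict (Ioc 0 L) with hμ
  choose s W hW using fun k : ℕ => exists_trigPolynomial_eLpNorm_sub_le hL hU
    (ε := ((k : ENNReal) + 1)⁻¹) (by simp)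
  set V : ℕ → ℝ → E := fun k t =>
    ∑ j ∈ s k, Complex.exp (Complex.I * (2 * Real.pi * j / L : ℝ) * t) • W k j with hVdef
  choose Y hY hYineq using fun k => exists_response_trigPolynomial hL hexp hM hpos (s k) (W k)
    (U := V k) rfl
  have hVc : ∀ k, Continuous (V k) := fun k => by simp only [hVdef]; fun_prop
  have hVmem : ∀ k, MemLp (V k) 2 μ := fun k => by
    obtain ⟨c, hc⟩ := isCompact_Icc.exists_bound_of_continuousOn (s := Icc 0 L)
      (hVc k).continuousOn
    refine MemLp.of_bound (hVc k).aestronglyMeasurable c ?_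
    filter_upwards [ae_restrict_mem measurableSet_Ioc] with t ht
    exact hc t (Ioc_subset_Icc_self ht)
  have hV2 : Tendsto (fun k => eLpNorm (V k - U) 2 μ) atTop (𝓝 0) := by
    refine tendsto_of_tendsto_of_tendsto_of_le_of_le tendsto_const_nhds
      (g := fun _ => 0) (h := fun k : ℕ => ((k : ENNReal) + 1)⁻¹) ?_ (fun _ => zero_le) fun k => ?_
    · have := (tendsto_add_atTop_iff_nat 1).2 ENNReal.tendsto_inv_nat_nhds_zero
      simpa using this
    · simp only
      rw [eLpNorm_sub_comm]
      exact hW k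
  have hVU : ∀ k, Integrable (fun t => V k t - U t) μ := fun k =>
    ((hVmem k).sub hU).integrable (by norm_num)
  have hV1 : Tendsto (fun k => ∫ t in (0 : ℝ)..L, ‖V k t - U t‖) atTop (𝓝 0) := by
    have h1 : Tendsto (fun k => eLpNorm (V k - U) 1 μ) atTop (𝓝 0) := by
      refine tendsto_of_tendsto_of_tendsto_of_le_of_le tendsto_const_nhds
        (g := fun _ => 0) (h := fun k : ℕ => eLpNorm (V k - U) 2 μ *
          μ univ ^ (1 / (1 : ENNReal).toReal - 1 / (2 : ENNReal).toReal)) ?_ (fun _ => zero_le)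
        fun k => eLpNorm_le_eLpNorm_mul_rpow_measure_univ (by norm_num)
          ((hVmem k).sub hU).aestronglyMeasurable
      have := ENNReal.Tendsto.mul_const (b := μ univ ^ (1 / (1 : ENNReal).toReal -
        1 / (2 : ENNReal).toReal)) hV2 (Or.inr (ENNReal.rpow_ne_top_of_nonneg (by norm_num)
          (measure_ne_top _ _)))
      simpa using this
    have h2 : ∀ k, ∫ t in (0 : ℝ)..L, ‖V k t - U t‖ = (eLpNorm (V k - U) 1 μ).toReal := fun k => by
      rw [intervalIntegral.integral_of_le hL.le, integral_norm_eq_lintegral_enorm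
        (hVU k).aestronglyMeasurable, eLpNorm_one_eq_lintegral_enorm]
      rfl
    simp_rw [h2]
    exact (ENNReal.tendsto_toReal ENNReal.zero_ne_top).comp h1
  -- By linearity the difference of the states solves the equation with input B(V_k - U), so
  -- Gronwall applies to it.
  have hYX : ∀ k, ∀ t ∈ Icc 0 L, ‖Y k t - X t‖ ≤
      Real.exp (‖a‖ * L) * (‖B‖ * ∫ t in (0 : ℝ)..L, ‖V k t - U t‖) := by
    intro k t ht
    refine (((hY k).sub hX).norm_le ht).trans ?_
    gcongr
    rw [← intervalIntegral.integral_const_mul]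
    refine intervalIntegral.integral_mono_on hL.le ?_ ?_ fun t _ => ?_
    · exact (((hY k).sub hX).intervalIntegrable_input ⟨hL.le, le_rfl⟩).norm
    · exact (((intervalIntegrable_iff_integrableOn_Ioc_of_le hL.le).2 (hVU k)).norm).const_mul _
    · rw [Pi.sub_apply, ← map_sub]
      exact B.le_opNorm _
  have hbd : Tendsto (fun k => Real.exp (‖a‖ * L) * (‖B‖ * ∫ t in (0 : ℝ)..L, ‖V k t - U t‖))
      atTop (𝓝 0) := by
    simpa using (hV1.const_mul ‖B‖).const_mul (Real.exp (‖a‖ * L))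
  have hT1 : Tendsto (fun k => ‖Y k L‖) atTop (𝓝 ‖X L‖) := by
    refine Tendsto.norm (tendsto_iff_norm_sub_tendsto_zero.2 ?_)
    exact squeeze_zero (fun _ => norm_nonneg _) (fun k => hYX k L ⟨hL.le, le_rfl⟩) hbd
  have hUi : IntervalIntegrable (fun t => ‖U t‖) volume 0 L :=
    (intervalIntegrable_iff_integrableOn_Ioc_of_le hL.le).2 (hU.integrable (by norm_num)).norm
  have hT2 : Tendsto (fun k => ∫ t in (0 : ℝ)..L, ‖V k t‖) atTop
      (𝓝 (∫ t in (0 : ℝ)..L, ‖U t‖)) := by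
    refine tendsto_iff_norm_sub_tendsto_zero.2
      (squeeze_zero (fun _ => norm_nonneg _) (fun k => ?_) hV1)
    rw [← intervalIntegral.integral_sub ((hVc k).norm.intervalIntegrable _ _) hUi]
    refine (intervalIntegral.norm_integral_le_integral_norm hL.le).trans ?_
    refine intervalIntegral.integral_mono_on hL.le
      (((hVc k).norm.intervalIntegrable _ _).sub hUi).norm
      ((intervalIntegrable_iff_integrableOn_Ioc_of_le hL.le).2 (hVU k)).norm fun t _ => ?_
    exact abs_norm_sub_norm_le _ _
  have hVlim : Tendsto (fun k => (hVmem k).toLp (V k)) atTop (𝓝 (hU.toLp U)) :=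
    (Lp.tendsto_Lp_iff_tendsto_eLpNorm'' _ _ _ _).2 hV2
  have hYlim : Tendsto (fun k => (hY k).memLp.toLp (Y k)) atTop (𝓝 (hX.memLp.toLp X)) := by
    refine (Lp.tendsto_Lp_iff_tendsto_eLpNorm'' _ _ _ _).2 ?_
    have hlim : Tendsto (fun k => μ univ ^ ((2 : ENNReal).toReal)⁻¹ * ENNReal.ofReal
        (Real.exp (‖a‖ * L) * (‖B‖ * ∫ t in (0 : ℝ)..L, ‖V k t - U t‖))) atTop (𝓝 0) := by
      have := ENNReal.Tendsto.const_mul (a := μ univ ^ ((2 : ENNReal).toReal)⁻¹)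
        (ENNReal.tendsto_ofReal hbd) (Or.inr (ENNReal.rpow_ne_top_of_nonneg (by norm_num)
          (measure_ne_top _ _)))
      simpa using this
    refine tendsto_of_tendsto_of_tendsto_of_le_of_le tendsto_const_nhds hlim
      (fun _ => zero_le) fun k => eLpNorm_le_of_ae_bound ?_
    filter_upwards [ae_restrict_mem measurableSet_Ioc] with t ht
    exact hYX k t (Ioc_subset_Icc_self ht)
  have hT3 : Tendsto (fun k => ∫ t in (0 : ℝ)..L, (inner ℂ (V k t) (H (Y k t) + J (V k t))).re)
      atTop (𝓝 (∫ t in (0 : ℝ)..L, (inner ℂ (U t) (H (X t) + J (U t))).re)) := by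
    rw [intervalIntegral_re_inner_eq hL.le hU hX.memLp]
    simp_rw [fun k => intervalIntegral_re_inner_eq (H := H) (J := J) hL.le (hVmem k) (hY k).memLp]
    refine (Complex.continuous_re.tendsto _).comp (hVlim.inner (Tendsto.add ?_ ?_))
    · exact ((H.compLpL 2 μ).continuous.tendsto _).comp hYlim
    · exact ((J.compLpL 2 μ).continuous.tendsto _).comp hVlim
  exact le_of_tendsto_of_tendsto' ((hT1.const_mul _).mul hT2).neg hT3 hYineq

/-- The frequency inequality on the imaginary axis implies that the supplied work is
nonnegative. -/
theorem supply_nonneg_of_frequency {τ : ℝ} (hτ : 0 < τ)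
    (hexp : ‖NormedSpace.exp ((τ : ℂ) • a)‖ ≤ 1 / 2)
    (hpos : ∀ (ω : ℝ) (z : K) (w : E), (Complex.I * ω) • z - a z = B w →
      0 ≤ (inner ℂ w (H z + J w)).re) {T : ℝ} (hT : 0 < T) {U : ℝ → E} {X : ℝ → K}
    (hU : MemLp U 2 (volume.restrict (Ioc 0 T))) (hX : SolvesState a (fun t => B (U t)) X T) :
    0 ≤ ∫ t in (0 : ℝ)..T, (inner ℂ (U t) (H (X t) + J (U t))).re := by
  obtain ⟨M, hM0, hM⟩ := exists_norm_exp_smul_le a hτ hexp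
  obtain ⟨k₀, hk₀⟩ := exists_nat_ge (T / τ)
  rw [div_le_iff₀ hτ] at hk₀
  set U' : ℝ → E := (Iic T).indicator U with hU'
  set X' : ℝ → K := fun t => if t ≤ T then X t else
    NormedSpace.exp (((t - T : ℝ) : ℂ) • a) (X T) with hX'
  have hBU : (Iic T).indicator (fun t => B (U t)) = fun t => B (U' t) := by
    ext t; by_cases ht : t ∈ Iic T <;> simp [hU', ht]
  have hmem : ∀ L, MemLp U' 2 (volume.restrict (Ioc 0 L)) := fun L => by
    rw [hU', memLp_indicator_iff_restrict measurableSet_Iic,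
      Measure.restrict_restrict measurableSet_Iic]
    have hsub : Iic T ∩ Ioc 0 L ⊆ Ioc 0 T := fun t ht => ⟨ht.2.1, ht.1⟩
    exact hU.mono_measure (Measure.restrict_mono hsub le_rfl)
  -- The horizon is L = (k₀ + j)τ ≥ T. With no input after T the work is the same over [0, L] as
  -- over [0, T], while the state decays freely from time k₀τ on and gains a factor 1/2 in each of
  -- the j further periods τ.
  have key : ∀ j : ℕ, -(2 * ‖H‖ * M * ((1 / 2) ^ j * ‖NormedSpace.exp
      (((k₀ * τ - T : ℝ) : ℂ) • a) (X T)‖) * ∫ t in (0 : ℝ)..T, ‖U t‖) ≤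
        ∫ t in (0 : ℝ)..T, (inner ℂ (U t) (H (X t) + J (U t))).re := by
    intro j
    -- This keeps exp(La) a contraction by 1/2 even for j = 0.
    have hk₀' : 1 ≤ k₀ := by
      rcases Nat.eq_zero_or_pos k₀ with h | h
      · rw [h, Nat.cast_zero, zero_mul] at hk₀
        linarith
      · exact h
    have hTL : T ≤ ((k₀ + j : ℕ) : ℝ) * τ := by
      push_cast
      nlinarith [mul_nonneg (Nat.cast_nonneg (α := ℝ) j) hτ.le]
    set L := ((k₀ + j : ℕ) : ℝ) * τ with hLdef
    have hexpL : ‖NormedSpace.exp ((L : ℂ) • a)‖ ≤ 1 / 2 := by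
      rw [hLdef, Complex.ofReal_mul, Complex.ofReal_natCast, exp_natCast_mul_smul a]
      refine (norm_pow_le' _ (by lia)).trans ?_
      refine (pow_le_pow_left₀ (norm_nonneg _) hexp _).trans ?_
      calc ((1 : ℝ) / 2) ^ (k₀ + j) ≤ (1 / 2) ^ 1 :=
            pow_le_pow_of_le_one (by norm_num) (by norm_num) (by lia)
        _ = 1 / 2 := pow_one _
    have h := supply_ge_of_frequency (hT.trans_le hTL) hexpL hM hpos (hmem L)
      (X := X') (hBU ▸ hX.extend (L := L) hT.le)
    have hXL : ‖X' L‖ ≤ (1 / 2) ^ j * ‖NormedSpace.exp (((k₀ * τ - T : ℝ) : ℂ) • a) (X T)‖ := by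
      have h1 : X' L = NormedSpace.exp (((L - T : ℝ) : ℂ) • a) (X T) := by
        rcases hTL.eq_or_lt with h | h
        · simp [hX', ← h]
        · exact if_neg h.not_ge
      have h2 : ((L - T : ℝ) : ℂ) = (j : ℂ) * τ + ((k₀ * τ - T : ℝ) : ℂ) := by
        rw [hLdef]; push_cast; ring
      rw [h1, h2, exp_add_smul a, exp_natCast_mul_smul a]
      refine (ContinuousLinearMap.le_opNorm (NormedSpace.exp ((τ : ℂ) • a) ^ j) _).trans ?_
      refine mul_le_mul_of_nonneg_right ?_ (norm_nonneg _)
      rcases Nat.eq_zero_or_pos j with h | h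
      · rw [h, pow_zero, pow_zero]
        exact ContinuousLinearMap.norm_id_le
      · exact (norm_pow_le' _ h).trans (pow_le_pow_left₀ (norm_nonneg _) hexp _)
    have hcut : ∀ g : ℝ → ℝ, ∫ t in (0 : ℝ)..L, (Iic T).indicator g t = ∫ t in (0 : ℝ)..T, g t := by
      intro g
      rw [intervalIntegral.integral_of_le (hT.le.trans hTL), intervalIntegral.integral_of_le hT.le,
        setIntegral_indicator measurableSet_Iic, Ioc_inter_Iic, min_eq_right hTL]
    have h3 : (fun t => ‖U' t‖) = (Iic T).indicator fun t => ‖U t‖ := by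
      ext t; by_cases ht : t ∈ Iic T <;> simp [hU', ht]
    have h4 : (fun t => (inner ℂ (U' t) (H (X' t) + J (U' t))).re) = (Iic T).indicator
        fun t => (inner ℂ (U t) (H (X t) + J (U t))).re := by
      ext t
      by_cases ht : t ∈ Iic T
      · have : X' t = X t := if_pos ht
        simp [hU', ht, this]
      · simp [hU', ht]
    rw [h3, h4, hcut, hcut] at h
    refine le_trans (neg_le_neg ?_) h
    have : 0 ≤ ∫ t in (0 : ℝ)..T, ‖U t‖ :=
      intervalIntegral.integral_nonneg hT.le fun _ _ => norm_nonneg _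
    gcongr
  have hlim : Tendsto (fun j : ℕ => -(2 * ‖H‖ * M * ((1 / 2) ^ j * ‖NormedSpace.exp
      (((k₀ * τ - T : ℝ) : ℂ) • a) (X T)‖) * ∫ t in (0 : ℝ)..T, ‖U t‖)) atTop (𝓝 0) := by
    have h1 := tendsto_pow_atTop_nhds_zero_of_lt_one (r := (1 / 2 : ℝ)) (by norm_num) (by norm_num)
    simpa using (((h1.mul_const ‖NormedSpace.exp
      (((k₀ * τ - T : ℝ) : ℂ) • a) (X T)‖).const_mul (2 * ‖H‖ * M)).mul_const
        (∫ t in (0 : ℝ)..T, ‖U t‖)).neg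
  exact le_of_tendsto' hlim key

/-- Nonnegative supply for a harmonic input over all time intervals implies the frequency
inequality. -/
theorem frequency_nonneg_of_supply {τ : ℝ} (hτ : 0 < τ)
    (hexp : ‖NormedSpace.exp ((τ : ℂ) • a)‖ ≤ 1 / 2) {ω : ℝ} {z : K} {w : E}
    (hpos : ∀ T : ℝ, 0 < T → 0 ≤ ∫ t in (0 : ℝ)..T,
      (inner ℂ (Complex.exp (Complex.I * ω * t) • w)
        (H (Complex.exp (Complex.I * ω * t) • z - NormedSpace.exp ((t : ℂ) • a) z) +
          J (Complex.exp (Complex.I * ω * t) • w))).re) :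
    0 ≤ (inner ℂ w (H z + J w)).re := by
  obtain ⟨M, hM0, hM⟩ := exists_norm_exp_smul_le a hτ hexp
  -- With iωp - ap = z, the bounded function q(t) = exp(-iωt) exp(ta) p is a primitive of -exp(-iωt)
  -- exp(ta) z, the transient seen in the rotating frame. Hence the work of the transient stays
  -- bounded in T.
  obtain ⟨p, hp⟩ := (bijective_resolvent a hexp ω).2 z
  simp only at hp
  set q : ℝ → K := fun t => Complex.exp (-(Complex.I * ω * t)) • NormedSpace.exp ((t : ℂ) • a) p
    with hq
  have hqd : ∀ t : ℝ, HasDerivAt q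
      (-(Complex.exp (-(Complex.I * ω * t)) • NormedSpace.exp ((t : ℂ) • a) z)) t := by
    intro t
    have h1 : HasDerivAt (fun t : ℝ => Complex.exp (-(Complex.I * ω * t)))
        (-(Complex.I * ω) * Complex.exp (-(Complex.I * ω * t))) t := by
      have := ((hasDerivAt_id (t : ℂ)).const_mul (-(Complex.I * ω))).cexp.comp_ofReal
      simpa [mul_comm, neg_mul, mul_neg] using this
    have h2 := h1.smul (hasDerivAt_exp_ofReal_smul_apply a p t)
    refine h2.congr_deriv ?_
    have hcomm : NormedSpace.exp ((t : ℂ) • a) (a p) = a (NormedSpace.exp ((t : ℂ) • a) p) :=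
      congrArg (fun f : K →L[ℂ] K => f p)
        (((Commute.refl a).smul_left (t : ℂ)).exp_left).eq
    rw [← hp, map_sub, map_smul, hcomm]
    module
  have hqc : Continuous fun t : ℝ => -(Complex.exp (-(Complex.I * ω * t)) •
      NormedSpace.exp ((t : ℂ) • a) z) := by
    have : Continuous fun t : ℝ => NormedSpace.exp ((t : ℂ) • a) z :=
      continuous_iff_continuousAt.2 fun t => (hasDerivAt_exp_ofReal_smul_apply a z t).continuousAt
    fun_prop
  have hpt : ∀ t : ℝ, (inner ℂ (Complex.exp (Complex.I * ω * t) • w)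
        (H (Complex.exp (Complex.I * ω * t) • z - NormedSpace.exp ((t : ℂ) • a) z) +
          J (Complex.exp (Complex.I * ω * t) • w))).re = (inner ℂ w (H z + J w)).re +
      (inner ℂ w (H (-(Complex.exp (-(Complex.I * ω * t)) •
        NormedSpace.exp ((t : ℂ) • a) z)))).re := by
    intro t
    have hconj : (starRingEnd ℂ) (Complex.exp (Complex.I * ω * t)) =
        Complex.exp (-(Complex.I * ω * t)) := by
      rw [← Complex.exp_conj]
      simp
    have hone : Complex.exp (-(Complex.I * ω * t)) * Complex.exp (Complex.I * ω * t) = 1 := by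
      rw [← Complex.exp_add]; simp
    rw [← Complex.add_re, inner_smul_left, hconj, ← inner_smul_right, ← inner_add_right]
    congr 2
    simp only [map_sub, map_smul, map_neg, smul_add, smul_sub, smul_smul, hone, one_smul]
    abel
  have hInt : ∀ T : ℝ, 0 < T → 0 ≤ T * (inner ℂ w (H z + J w)).re +
      (inner ℂ w (H (q T - q 0))).re := by
    intro T hT
    have h := hpos T hT
    simp_rw [hpt] at h
    rw [intervalIntegral.integral_add (by simp) (Continuous.intervalIntegrable (by fun_prop) _ _),
      intervalIntegral.integral_const, sub_zero, smul_eq_mul] at h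
    convert h using 2
    rw [← intervalIntegral.integral_eq_sub_of_hasDerivAt (fun t _ => hqd t)
      (hqc.intervalIntegrable _ _)]
    exact ((Complex.reCLM.comp
      (((innerSL ℂ w).comp H).restrictScalars ℝ)).intervalIntegral_comp_comm
      (hqc.intervalIntegrable 0 T)).symm
  have hbound : ∀ T : ℝ, 0 ≤ T → (inner ℂ w (H (q T - q 0))).re ≤
      ‖w‖ * (‖H‖ * (M * ‖p‖ + M * ‖p‖)) := by
    intro T hT
    have hqb : ∀ t : ℝ, 0 ≤ t → ‖q t‖ ≤ M * ‖p‖ := fun t ht => by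
      have : ‖Complex.exp (-(Complex.I * ω * t))‖ = 1 := by
        rw [Complex.norm_exp]; simp
      rw [hq, norm_smul, this, one_mul]
      exact ContinuousLinearMap.le_of_opNorm_le _ (hM t ht) _
    refine (Complex.re_le_norm _).trans ((norm_inner_le_norm _ _).trans ?_)
    gcongr
    refine (H.le_opNorm _).trans ?_
    gcongr
    exact (norm_sub_le _ _).trans (add_le_add (hqb T hT) (hqb 0 le_rfl))
  by_contra! hneg
  set r := (inner ℂ w (H z + J w)).re
  set c := ‖w‖ * (‖H‖ * (M * ‖p‖ + M * ‖p‖))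
  have hc : 0 ≤ c := by positivity
  -- At this T the work is at most Tr + c = -1, a contradiction.
  have hT0 : 0 < (c + 1) / (-r) := by apply div_pos <;> linarith
  have h1 := hInt _ hT0
  have h2 := hbound _ hT0.le
  have h3 : (c + 1) / (-r) * r = -(c + 1) := by
    have : r ≠ 0 := hneg.ne
    field_simp
  linarith

end Frequency

/-! ### Hurwitz matrices -/

section Hurwitz

variable {n : ℕ}

theorem exp_mulVec_of_eigenvector {A : Matrix (Fin n) (Fin n) ℂ} {μ : ℂ} {v : Fin n → ℂ}
    (h : A.mulVec v = μ • v) : (NormedSpace.exp A).mulVec v = Complex.exp μ • v := by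
  have hpow : ∀ k : ℕ, (A ^ k).mulVec v = μ ^ k • v := by
    intro k
    induction k with
    | zero => simp
    | succ k ih =>
      rw [pow_succ', ← Matrix.mulVec_mulVec, ih, Matrix.mulVec_smul, h, smul_smul, pow_succ]
  have h1 := (NormedSpace.exp_series_hasSum_exp' (𝕂 := ℂ) A).map
    (Matrix.mulVecBilin ℂ ℂ |>.flip v : Matrix (Fin n) (Fin n) ℂ →ₗ[ℂ] (Fin n → ℂ))
    (LinearMap.continuous_of_finiteDimensional _)
  have h2 := (NormedSpace.exp_series_hasSum_exp' (𝕂 := ℂ) μ).smul_const v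
  rw [← Complex.exp_eq_exp_ℂ] at h2
  refine h1.unique (h2.congr_fun fun k => ?_)
  simp [hpow, smul_smul]

/-- `A` commutes with its exponential and so preserves the eigenspace of exp(A) at z. An eigenvector
of `A` in that space, with eigenvalue μ, is multiplied by exp(μ) and by z alike. -/
theorem exists_exp_eq_of_mem_spectrum_exp {A : Matrix (Fin n) (Fin n) ℂ} {z : ℂ}
    (hz : z ∈ spectrum ℂ (NormedSpace.exp A)) : ∃ μ ∈ spectrum ℂ A, z = Complex.exp μ := by
  have hcomm : Commute (Matrix.toLin' (NormedSpace.exp A)) (Matrix.toLin' A) :=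
    ((Commute.refl A).exp_left).map (Matrix.toLinAlgEquiv' (R := ℂ) (n := Fin n))
  have hz' : Module.End.HasEigenvalue (Matrix.toLin' (NormedSpace.exp A)) z := by
    rw [Module.End.hasEigenvalue_iff_mem_spectrum, Matrix.spectrum_toLin']
    exact hz
  set W := Module.End.eigenspace (Matrix.toLin' (NormedSpace.exp A)) z with hW
  have hmaps : MapsTo (Matrix.toLin' A) W W :=
    Module.End.mapsTo_genEigenspace_of_comm hcomm z 1
  have : Nontrivial W := Submodule.nontrivial_iff_ne_bot.2 hz'
  obtain ⟨μ, hμ⟩ := Module.End.exists_eigenvalue ((Matrix.toLin' A).restrict hmaps)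
  obtain ⟨v, hv⟩ := hμ.exists_hasEigenvector
  have hAv : A.mulVec (v : Fin n → ℂ) = μ • (v : Fin n → ℂ) := by
    have h : Matrix.toLin' A (v : Fin n → ℂ) = μ • (v : Fin n → ℂ) :=
      congrArg Subtype.val hv.apply_eq_smul
    simpa using h
  have hv0 : (v : Fin n → ℂ) ≠ 0 := fun h => hv.2 (Subtype.ext h)
  have hev : (NormedSpace.exp A).mulVec (v : Fin n → ℂ) = z • (v : Fin n → ℂ) := by
    simpa using Module.End.mem_eigenspace_iff.1 v.2
  refine ⟨μ, ?_, ?_⟩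
  · rw [← Matrix.spectrum_toLin', ← Module.End.hasEigenvalue_iff_mem_spectrum]
    exact Module.End.hasEigenvalue_of_hasEigenvector
      (Module.End.hasEigenvector_iff.2 ⟨Module.End.mem_eigenspace_iff.2 (by simpa using hAv), hv0⟩)
  · rw [exp_mulVec_of_eigenvector hAv] at hev
    exact (smul_left_injective ℂ hv0 hev).symm

/-- The spectrum of exp(A) lies in the open unit disc, so its spectral radius is below some r < 1,
and Gelfand's formula gives ‖exp(A)^k‖ < r^k for large k. -/
theorem IsHurwitz.tendsto_norm_exp {A : Matrix (Fin n) (Fin n) ℂ} (hA : IsHurwitz A) :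
    Tendsto (fun k : ℕ => ‖NormedSpace.exp ((k : ℂ) • A)‖) atTop (𝓝 0) := by
  rcases subsingleton_or_nontrivial (Matrix (Fin n) (Fin n) ℂ) with hs | hs
  · simp [Subsingleton.elim _ (0 : Matrix (Fin n) (Fin n) ℂ)]
  have hpow : ∀ k : ℕ, NormedSpace.exp ((k : ℂ) • A) = NormedSpace.exp A ^ k := fun k => by
    simpa using exp_natCast_mul_smul A 1 k
  simp_rw [hpow]
  have hrad : spectralRadius ℂ (NormedSpace.exp A) < ((1 : NNReal) : ENNReal) := by
    refine spectrum.spectralRadius_lt_of_forall_lt _ fun z hz => ?_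
    obtain ⟨μ, hμ, rfl⟩ := exists_exp_eq_of_mem_spectrum_exp hz
    rw [← NNReal.coe_lt_coe, coe_nnnorm, Complex.norm_exp, NNReal.coe_one, Real.exp_lt_one_iff]
    exact hA μ hμ
  obtain ⟨r, hr1, hr2⟩ := ENNReal.lt_iff_exists_nnreal_btwn.1 hrad
  have hev := (spectrum.pow_nnnorm_pow_one_div_tendsto_nhds_spectralRadius
    (NormedSpace.exp A)).eventually (gt_mem_nhds hr1)
  have hr3 : (r : ℝ) < 1 := by exact_mod_cast hr2
  refine squeeze_zero' (Eventually.of_forall fun _ => norm_nonneg _) ?_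
    (tendsto_pow_atTop_nhds_zero_of_lt_one r.2 hr3)
  filter_upwards [hev, eventually_gt_atTop 0] with k hk hk0
  have h1 := ENNReal.rpow_le_rpow hk.le (Nat.cast_nonneg (α := ℝ) k)
  rw [← ENNReal.rpow_mul, one_div, inv_mul_cancel₀ (by positivity), ENNReal.rpow_one,
    ENNReal.rpow_natCast] at h1
  exact_mod_cast h1

theorem IsHurwitz.isUnit_det {A : Matrix (Fin n) (Fin n) ℂ} (hA : IsHurwitz A) (ω : ℝ) :
    IsUnit ((Complex.I * ω) • (1 : Matrix (Fin n) (Fin n) ℂ) - A).det := by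
  rw [← Matrix.isUnit_iff_isUnit_det, ← Algebra.algebraMap_eq_smul_one]
  by_contra h
  have := hA _ (spectrum.mem_iff.2 h)
  simp at this

end Hurwitz

/-! ### Multiplication operators on `L²` -/

section Multiplication

variable {Ω : Type*} [MeasurableSpace Ω] {μ : Measure Ω} {p q r n : ℕ}

/-- Matrix-vector multiplication as a continuous bilinear map. -/
noncomputable def matrixAction (p q : ℕ) : Matrix (Fin p) (Fin q) ℂ →L[ℂ]
    EuclideanSpace ℂ (Fin q) →L[ℂ] EuclideanSpace ℂ (Fin p) :=
  LinearMap.toContinuousLinearMap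
    ((Matrix.toEuclideanLin (𝕜 := ℂ) (m := Fin p) (n := Fin q)).trans
      LinearMap.toContinuousLinearMap : Matrix (Fin p) (Fin q) ℂ →ₗ[ℂ] _)

/-- Multiplication by a bounded matrix-valued function. -/
noncomputable def mulOp {S : Ω → Matrix (Fin p) (Fin q) ℂ} (hS : MemLp S ⊤ μ) :
    Lp (EuclideanSpace ℂ (Fin q)) 2 μ →L[ℂ] Lp (EuclideanSpace ℂ (Fin p)) 2 μ :=
  (matrixAction p q).holderL μ ⊤ 2 2 (hS.toLp S)

theorem coeFn_mulOp {S : Ω → Matrix (Fin p) (Fin q) ℂ} (hS : MemLp S ⊤ μ)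
    (f : Lp (EuclideanSpace ℂ (Fin q)) 2 μ) :
    mulOp hS f =ᵐ[μ] fun σ => Matrix.toEuclideanLin (S σ) (f σ) := by
  filter_upwards [(matrixAction p q).coeFn_holder (r := 2) (hS.toLp S) f, hS.coeFn_toLp]
    with σ h1 h2
  exact h1.trans (by rw [h2]; rfl)

theorem norm_toEuclideanLin_le (M : Matrix (Fin p) (Fin q) ℂ) (v : EuclideanSpace ℂ (Fin q)) :
    ‖Matrix.toEuclideanLin M v‖ ≤ ‖M‖ * ‖v‖ :=
  Matrix.l2_opNorm_mulVec M v

theorem toEuclideanLin_mul_apply (M : Matrix (Fin p) (Fin q) ℂ) (N : Matrix (Fin q) (Fin r) ℂ)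
    (v : EuclideanSpace ℂ (Fin r)) : Matrix.toEuclideanLin (M * N) v =
      Matrix.toEuclideanLin M (Matrix.toEuclideanLin N v) := by
  ext i
  simp [Matrix.toLpLin_apply, Matrix.mulVec_mulVec]

theorem coeFn_pow_mulOp {S : Ω → Matrix (Fin n) (Fin n) ℂ} (hS : MemLp S ⊤ μ)
    (f : Lp (EuclideanSpace ℂ (Fin n)) 2 μ) (k : ℕ) :
    (mulOp hS ^ k) f =ᵐ[μ] fun σ => Matrix.toEuclideanLin (S σ ^ k) (f σ) := by
  induction k with
  | zero => exact Eventually.of_forall fun σ => by simp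
  | succ k ih =>
    rw [pow_succ']
    filter_upwards [coeFn_mulOp hS ((mulOp hS ^ k) f), ih] with σ h1 h2
    refine h1.trans ?_
    rw [h2, pow_succ', toEuclideanLin_mul_apply]

/-- The partial sums of the exponential series converge in L², hence almost everywhere along a
subsequence; pointwise they converge to the matrix exponential, so the two limits agree. -/
theorem coeFn_exp_mulOp {S : Ω → Matrix (Fin n) (Fin n) ℂ} (hS : MemLp S ⊤ μ)
    (f : Lp (EuclideanSpace ℂ (Fin n)) 2 μ) :
    NormedSpace.exp (mulOp hS) f =ᵐ[μ]
      fun σ => Matrix.toEuclideanLin (NormedSpace.exp (S σ)) (f σ) := by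
  have hpart : ∀ N : ℕ, ((∑ k ∈ Finset.range N, ((k.factorial : ℂ)⁻¹ • mulOp hS ^ k) f :
      Lp (EuclideanSpace ℂ (Fin n)) 2 μ) : Ω → EuclideanSpace ℂ (Fin n)) =ᵐ[μ] fun σ =>
        matrixAction n n (∑ k ∈ Finset.range N, (k.factorial : ℂ)⁻¹ • S σ ^ k) (f σ) := by
    intro N
    induction N with
    | zero =>
      simp only [Finset.range_zero, Finset.sum_empty, map_zero]
      exact Lp.coeFn_zero _ _ _
    | succ N ih =>
      rw [Finset.sum_range_succ]
      filter_upwards [Lp.coeFn_add (∑ k ∈ Finset.range N,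
        ((k.factorial : ℂ)⁻¹ • mulOp hS ^ k) f) (((N.factorial : ℂ)⁻¹ • mulOp hS ^ N) f), ih,
        Lp.coeFn_smul ((N.factorial : ℂ)⁻¹) ((mulOp hS ^ N) f), coeFn_pow_mulOp hS f N]
        with σ h1 h2 h3 h4
      rw [h1, Pi.add_apply, h2, Finset.sum_range_succ, map_add, _root_.add_apply]
      congr 1
      refine h3.trans ?_
      rw [Pi.smul_apply, h4, map_smul]
      rfl
  have hconv : Tendsto (fun N => ∑ k ∈ Finset.range N, ((k.factorial : ℂ)⁻¹ • mulOp hS ^ k) f)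
      atTop (𝓝 (NormedSpace.exp (mulOp hS) f)) :=
    ((NormedSpace.exp_series_hasSum_exp' (𝕂 := ℂ) (mulOp hS)).mapL
      (ContinuousLinearMap.apply ℂ _ f)).tendsto_sum_nat
  obtain ⟨ns, hns, hae⟩ := (tendstoInMeasure_of_tendsto_Lp hconv).exists_seq_tendsto_ae
  filter_upwards [hae, ae_all_iff.2 hpart] with σ h1 h2
  refine tendsto_nhds_unique h1 ?_
  simp_rw [h2]
  have h3 := ((NormedSpace.exp_series_hasSum_exp' (𝕂 := ℂ) (S σ)).tendsto_sum_nat).comp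
    hns.tendsto_atTop
  have h4 := ((((ContinuousLinearMap.apply ℂ _ (f σ)).comp
    (matrixAction n n)).continuous.tendsto _).comp h3)
  exact h4

theorem norm_exp_smul_mulOp_le {S : Ω → Matrix (Fin n) (Fin n) ℂ} (hS : MemLp S ⊤ μ) (t : ℂ)
    {c : ℝ} (hc : 0 ≤ c) (h : ∀ᵐ σ ∂μ, ‖NormedSpace.exp (t • S σ)‖ ≤ c) :
    ‖NormedSpace.exp (t • mulOp hS)‖ ≤ c := by
  have hsmul : t • mulOp hS = mulOp (hS.const_smul t) := by
    exact (map_smul ((matrixAction n n).holderL μ ⊤ 2 2) t (hS.toLp S)).symm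
  rw [hsmul]
  refine ContinuousLinearMap.opNorm_le_bound _ hc fun f =>
    Lp.norm_le_mul_norm_of_ae_le_mul ?_
  filter_upwards [coeFn_exp_mulOp (hS.const_smul t) f, h] with σ h1 h2
  rw [h1]
  exact (norm_toEuclideanLin_le _ _).trans (by gcongr; exact h2)

end Multiplication

/-! ### Fourier series on the torus -/

section Fourier

variable {ν : ℕ}

theorem conj_character (ℓ : Lattice ν) (σ : Torus ν) :
    (starRingEnd ℂ) (character ℓ σ) = character (-ℓ) σ := by
  simp only [character, ContinuousMap.coe_mk, map_prod, ← fourier_neg, Pi.neg_apply]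

theorem character_add (k ℓ : Lattice ν) (σ : Torus ν) :
    character (k + ℓ) σ = character k σ * character ℓ σ := by
  simp only [character, ContinuousMap.coe_mk, Pi.add_apply, neg_add, fourier_add,
    Finset.prod_mul_distrib]

theorem character_zero : character (0 : Lattice ν) = 1 := by
  ext σ
  simp [character]

theorem integral_fourier_eq_ite {L : ℝ} [hL : Fact (0 < L)] (k : ℤ) :
    ∫ θ : AddCircle L, fourier k θ = if k = 0 then (L : ℂ) else 0 := by
  split_ifs with hk
  · simp [hk, Measure.real, AddCircle.measure_univ, hL.out.le]
  · exact integral_eq_zero_of_add_right_eq_neg (fourier_add_half_inv_index hk hL.out)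

theorem integral_character (ℓ : Lattice ν) :
    ∫ σ : Torus ν, character ℓ σ = if ℓ = 0 then ((2 * Real.pi) ^ ν : ℂ) else 0 := by
  have h := integral_fintype_prod_volume_eq_prod (𝕜 := ℂ)
    (fun (k : Fin ν) (θ : AddCircle (2 * Real.pi)) => (fourier (-ℓ k) θ : ℂ))
  refine Eq.trans h ?_
  simp_rw [integral_fourier_eq_ite, neg_eq_zero]
  split_ifs with hℓ
  · simp [hℓ]
  · obtain ⟨i, hi⟩ := Function.ne_iff.1 hℓ
    exact Finset.prod_eq_zero (Finset.mem_univ i) (if_neg hi)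

/-- Stone–Weierstrass: characters are closed under products and conjugation, so the algebra they
generate is their span, and the coordinate exponentials separate points. -/
theorem span_character_closure_eq_top :
    (Submodule.span ℂ (range (character (ν := ν)))).topologicalClosure = ⊤ := by
  let 𝒮 : StarSubalgebra ℂ C(Torus ν, ℂ) :=
    { toSubalgebra := Algebra.adjoin ℂ (range character)
      star_mem' := by
        change Algebra.adjoin ℂ (range character) ≤ star (Algebra.adjoin ℂ (range character))
        refine Algebra.adjoin_le ?_
        rintro _ ⟨ℓ, rfl⟩
        refine Algebra.subset_adjoin ⟨-ℓ, ?_⟩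
        ext1 σ
        simp only [← conj_character, starRingEnd_apply, ContinuousMap.star_apply] }
  have hspan : 𝒮.toSubalgebra.toSubmodule = Submodule.span ℂ (range (character (ν := ν))) := by
    apply Algebra.adjoin_eq_span_of_subset
    refine .trans (fun x => Submonoid.closure_induction (fun _ => id) ⟨0, character_zero⟩ ?_)
      Submodule.subset_span
    rintro _ _ _ _ ⟨k, rfl⟩ ⟨ℓ, rfl⟩
    exact ⟨k + ℓ, by ext σ; exact character_add k ℓ σ⟩
  have hsep : 𝒮.SeparatesPoints := by
    intro x y hxy
    obtain ⟨i, hi⟩ := Function.ne_iff.1 hxy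
    -- The index is -1 because `character` carries a minus sign: this one is exp(iσ_i).
    refine ⟨_, ⟨character (Pi.single i (-1)), Algebra.subset_adjoin ⟨_, rfl⟩, rfl⟩, ?_⟩
    have hs : ∀ z : Torus ν, character (Pi.single i (-1)) z = fourier 1 (z i) := by
      intro z
      simp only [character, ContinuousMap.coe_mk]
      rw [Finset.prod_eq_single i]
      · simp
      · intro j _ hj
        simp [Pi.single_eq_of_ne hj]
      · simp
    simp only [hs, fourier_one]
    intro h
    exact hi (AddCircle.injective_toCircle Real.two_pi_pos.ne' (Subtype.coe_injective h))
  rw [← hspan]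
  exact congrArg (Subalgebra.toSubmodule <| StarSubalgebra.toSubalgebra ·)
    (ContinuousMap.starSubalgebra_topologicalClosure_eq_top_of_separatesPoints 𝒮 hsep)

/-- The character `exp (-i ℓᵀσ)` in `L²`. -/
noncomputable abbrev characterLp (ℓ : Lattice ν) : Lp ℂ 2 (volume : Measure (Torus ν)) :=
  ContinuousMap.toLp 2 (volume : Measure (Torus ν)) ℂ (character ℓ)

theorem coeFn_characterLp (ℓ : Lattice ν) : characterLp ℓ =ᵐ[volume] character ℓ :=
  ContinuousMap.coeFn_toLp volume (character ℓ)

/-- The `L²` norm of a character. -/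
noncomputable def characterNorm (ν : ℕ) : ℝ := √((2 * Real.pi) ^ ν)

theorem characterNorm_pos : 0 < characterNorm ν :=
  Real.sqrt_pos.2 (pow_pos Real.two_pi_pos ν)

theorem characterNorm_mul_self :
    (characterNorm ν : ℂ) * characterNorm ν = (2 * Real.pi) ^ ν := by
  rw [← Complex.ofReal_mul, characterNorm, Real.mul_self_sqrt (pow_pos Real.two_pi_pos ν).le]
  push_cast
  rfl

theorem characterNorm_ne_zero : (characterNorm ν : ℂ) ≠ 0 :=
  Complex.ofReal_ne_zero.2 characterNorm_pos.ne'

theorem orthonormal_character :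
    Orthonormal ℂ fun ℓ : Lattice ν => ((characterNorm ν : ℂ)⁻¹) • characterLp ℓ := by
  rw [orthonormal_iff_ite]
  intro k ℓ
  rw [inner_smul_left, inner_smul_right, ContinuousMap.inner_toLp]
  simp_rw [conj_character, ← character_add, integral_character, ← sub_eq_add_neg, sub_eq_zero,
    map_inv₀, Complex.conj_ofReal, eq_comm (a := ℓ)]
  split_ifs
  · rw [← characterNorm_mul_self]
    have := characterNorm_ne_zero (ν := ν)
    field_simp
  · simp

theorem span_normalized_character_closure_eq_top :
    (Submodule.span ℂ (range fun ℓ : Lattice ν =>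
      ((characterNorm ν : ℂ)⁻¹) • characterLp ℓ)).topologicalClosure = ⊤ := by
  have h : (Submodule.span ℂ (range (characterLp (ν := ν)))).topologicalClosure = ⊤ := by
    simpa only [Submodule.map_span, ContinuousLinearMap.coe_coe, ← range_comp, Function.comp_def]
      using (ContinuousMap.toLp_denseRange ℂ (volume : Measure (Torus ν)) ℂ
        (by simp : (2 : ENNReal) ≠ ⊤)).topologicalClosure_map_submodule
          span_character_closure_eq_top
  refine top_unique (h.ge.trans (Submodule.topologicalClosure_mono (Submodule.span_le.2 ?_)))
  rintro _ ⟨ℓ, rfl⟩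
  have : characterLp ℓ = (characterNorm ν : ℂ) • ((characterNorm ν : ℂ)⁻¹) • characterLp ℓ := by
    rw [smul_smul, mul_inv_cancel₀ characterNorm_ne_zero, one_smul]
  rw [this]
  exact Submodule.smul_mem _ _ (Submodule.subset_span ⟨ℓ, rfl⟩)

/-- The normalized characters form a Hilbert basis of `L²(𝕋^ν)`. -/
noncomputable def characterBasis (ν : ℕ) :
    HilbertBasis (Lattice ν) ℂ (Lp ℂ 2 (volume : Measure (Torus ν))) :=
  HilbertBasis.mk orthonormal_character span_normalized_character_closure_eq_top.ge

theorem characterBasis_apply (ℓ : Lattice ν) :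
    characterBasis ν ℓ = ((characterNorm ν : ℂ)⁻¹) • characterLp ℓ :=
  congrFun (HilbertBasis.coe_mk _ _) ℓ

theorem coeFn_characterBasis (ℓ : Lattice ν) :
    characterBasis ν ℓ =ᵐ[volume] fun σ => (characterNorm ν : ℂ)⁻¹ * character ℓ σ := by
  rw [characterBasis_apply]
  filter_upwards [Lp.coeFn_smul ((characterNorm ν : ℂ)⁻¹) (characterLp ℓ), coeFn_characterLp ℓ]
    with σ h1 h2
  rw [h1, Pi.smul_apply, h2, smul_eq_mul]

/-- The Fourier series with square summable real coefficients. -/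
noncomputable def scalarSymbol (a : Lattice ν → ℝ) : Lp ℂ 2 (volume : Measure (Torus ν)) :=
  ∑' ℓ, (a ℓ : ℂ) • characterLp ℓ

/-- The factor `characterNorm ν` arises because the series uses plain characters while the basis is
normalized. -/
theorem repr_scalarSymbol {a : Lattice ν → ℝ} (ha : Summable fun ℓ => a ℓ ^ 2) (ℓ : Lattice ν) :
    (characterBasis ν).repr (scalarSymbol a) ℓ = characterNorm ν * a ℓ := by
  have hmem : Memℓp (fun ℓ => (characterNorm ν : ℂ) * a ℓ) 2 := by
    refine memℓp_gen ?_
    simpa [mul_pow] using ha.mul_left (characterNorm ν ^ 2)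
  have h := (characterBasis ν).hasSum_repr_symm ⟨_, hmem⟩
  have h2 : scalarSymbol a = (characterBasis ν).repr.symm ⟨_, hmem⟩ := by
    rw [← h.tsum_eq, scalarSymbol]
    congr 1 with ℓ : 1
    simp only [characterBasis_apply, smul_smul]
    congr 1
    field_simp [characterNorm_ne_zero (ν := ν)]
  rw [h2, LinearIsometryEquiv.apply_symm_apply]

/-- The Fourier coefficients of a product are the convolution of the Fourier coefficients. -/
theorem hasSum_repr_mul {a : Lattice ν → ℝ} (ha : Summable fun ℓ => a ℓ ^ 2)
    {f h : Lp ℂ 2 (volume : Measure (Torus ν))}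
    (hfh : h =ᵐ[volume] fun σ => scalarSymbol a σ * f σ) (j : Lattice ν) :
    HasSum (fun k => (a (j - k) : ℂ) * (characterBasis ν).repr f k)
      ((characterBasis ν).repr h j) := by
  set s := scalarSymbol a
  -- With e_j the j-th basis function, ⟨e_j, s f⟩ = ⟨s̄ e_j, f⟩. The vector s̄ e_j is in L² even if
  -- s is unbounded, so Parseval applies to this pair, and the coefficients of s̄ e_j are shifted
  -- coefficients of s.
  have hg : MemLp (fun σ => (starRingEnd ℂ) (s σ) * ((characterNorm ν : ℂ)⁻¹ * character j σ)) 2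
      (volume : Measure (Torus ν)) := by
    refine MemLp.of_le_mul (g := s) (c := ‖(characterNorm ν : ℂ)⁻¹‖ * ‖character j‖) (Lp.memLp s)
      ?_ ?_
    · exact (Complex.continuous_conj.comp_aestronglyMeasurable
        (Lp.aestronglyMeasurable s)).mul (by fun_prop)
    · refine Eventually.of_forall fun σ => ?_
      rw [norm_mul, norm_mul, RCLike.norm_conj, mul_comm]
      gcongr
      exact (character j).norm_coe_le_norm σ
  have hsum := (characterBasis ν).hasSum_inner_mul_inner (hg.toLp _) f
  have h1 : inner ℂ (hg.toLp _) f = (characterBasis ν).repr h j := by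
    rw [HilbertBasis.repr_apply_apply, L2.inner_def, L2.inner_def]
    refine integral_congr_ae ?_
    filter_upwards [hg.coeFn_toLp, hfh, coeFn_characterBasis j] with σ h1 h2 h3
    rw [h1, h2, h3]
    simp only [RCLike.inner_apply, map_mul, Complex.conj_conj]
    ring
  have h2 : ∀ k, inner ℂ (hg.toLp _) (characterBasis ν k) = (a (j - k) : ℂ) := by
    intro k
    have h3 : inner ℂ (hg.toLp _) (characterBasis ν k) =
        (characterNorm ν : ℂ)⁻¹ * (characterBasis ν).repr s (j - k) := by
      rw [HilbertBasis.repr_apply_apply, L2.inner_def, L2.inner_def, ← integral_const_mul]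
      refine integral_congr_ae ?_
      filter_upwards [hg.coeFn_toLp, coeFn_characterBasis k, coeFn_characterBasis (j - k)]
        with σ h1 h2 h3
      rw [h1, h2, h3]
      have h4 : character j σ = character (j - k) σ * character k σ := by
        rw [← character_add, sub_add_cancel]
      have h5 : character k σ * (starRingEnd ℂ) (character k σ) = 1 := by
        rw [conj_character, ← character_add, add_neg_cancel, character_zero]
        rfl
      simp only [RCLike.inner_apply, map_mul, Complex.conj_conj, h4, map_inv₀, Complex.conj_ofReal]
      linear_combination (s σ * ((characterNorm ν : ℂ)⁻¹) ^ 2 *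
        (starRingEnd ℂ) (character (j - k) σ)) * h5
    rw [h3, repr_scalarSymbol ha, inv_mul_cancel_left₀ characterNorm_ne_zero]
  rw [h1] at hsum
  refine hsum.congr_fun fun k => ?_
  rw [h2, HilbertBasis.repr_apply_apply]

end Fourier

/-! ### Vector-valued Fourier series and block Toeplitz operators -/

section VectorFourier

variable {ν p q : ℕ}

/-- The Hilbert space `L²(𝕋^ν, ℂ^p)`. -/
abbrev TorusL2 (ν p : ℕ) : Type :=
  Lp (EuclideanSpace ℂ (Fin p)) 2 (volume : Measure (Torus ν))

/-- The `i`-th component of a vector-valued function. -/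
noncomputable def component (i : Fin p) :
    TorusL2 ν p →L[ℂ] Lp ℂ 2 (volume : Measure (Torus ν)) :=
  (EuclideanSpace.proj i : EuclideanSpace ℂ (Fin p) →L[ℂ] ℂ).compLpL 2 volume

theorem coeFn_component (i : Fin p) (f : TorusL2 ν p) :
    component i f =ᵐ[volume] fun σ => f σ i :=
  (EuclideanSpace.proj i : EuclideanSpace ℂ (Fin p) →L[ℂ] ℂ).coeFn_compLpL f

/-- The `i`-th component of the Fourier coefficient at `ℓ`. -/
noncomputable def fourierCoef (f : TorusL2 ν p) (ℓ : Lattice ν) (i : Fin p) : ℂ :=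
  (characterBasis ν).repr (component i f) ℓ

theorem fourierCoef_add (f g : TorusL2 ν p) (ℓ : Lattice ν) (i : Fin p) :
    fourierCoef (f + g) ℓ i = fourierCoef f ℓ i + fourierCoef g ℓ i := by
  simp [fourierCoef]

theorem fourierCoef_smul (c : ℂ) (f : TorusL2 ν p) (ℓ : Lattice ν) (i : Fin p) :
    fourierCoef (c • f) ℓ i = c * fourierCoef f ℓ i := by
  simp [fourierCoef]

theorem hasSum_inner_fourierCoef (f g : TorusL2 ν p) :
    HasSum (fun ℓ => ∑ i, (starRingEnd ℂ) (fourierCoef f ℓ i) * fourierCoef g ℓ i)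
      (inner ℂ f g) := by
  have h : inner ℂ f g = ∑ i, inner ℂ (component i f) (component i g) := by
    simp_rw [L2.inner_def]
    rw [← integral_finsetSum _ fun i _ => L2.integrable_inner _ _]
    refine integral_congr_ae ?_
    filter_upwards [ae_all_iff.2 fun i => coeFn_component i f,
      ae_all_iff.2 fun i => coeFn_component i g] with σ h1 h2
    rw [PiLp.inner_apply]
    exact Finset.sum_congr rfl fun i _ => by rw [h1, h2]
  rw [h]
  refine hasSum_sum fun i _ => ?_
  refine ((characterBasis ν).hasSum_inner_mul_inner _ _).congr_fun fun ℓ => ?_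
  simp only [fourierCoef, HilbertBasis.repr_apply_apply, inner_conj_symm]

theorem summable_norm_sq_fourierCoef (f : TorusL2 ν p) :
    Summable fun ℓ => ∑ i, ‖fourierCoef f ℓ i‖ ^ 2 := by
  have h := (Complex.reCLM.hasSum (hasSum_inner_fourierCoef f f)).summable
  refine h.congr fun ℓ => ?_
  rw [Complex.reCLM_apply, Complex.re_sum]
  refine Finset.sum_congr rfl fun i _ => ?_
  rw [Complex.conj_mul', ← Complex.ofReal_pow, Complex.ofReal_re]

/-- The real parts of the Fourier coefficients, as a linear map. -/
noncomputable def reCoefₗ : TorusL2 ν p →ₗ[ℝ] SqSum ν p where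
  toFun f := ⟨fun ℓ => WithLp.toLp 2 fun i => (fourierCoef f ℓ i).re, by
    refine memℓp_gen ?_
    refine Summable.of_nonneg_of_le (fun _ => by positivity) (fun ℓ => ?_)
      (summable_norm_sq_fourierCoef f)
    simp only [ENNReal.toReal_ofNat, Real.rpow_ofNat, EuclideanSpace.norm_sq_eq]
    refine Finset.sum_le_sum fun i _ => ?_
    gcongr
    exact Complex.abs_re_le_norm _⟩
  map_add' f g := by
    ext ℓ i
    change (fourierCoef (f + g) ℓ i).re = (fourierCoef f ℓ i).re + (fourierCoef g ℓ i).re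
    rw [fourierCoef_add, Complex.add_re]
  map_smul' c f := by
    ext ℓ i
    change (fourierCoef (c • f) ℓ i).re = c * (fourierCoef f ℓ i).re
    rw [RCLike.real_smul_eq_coe_smul (K := ℂ), fourierCoef_smul]
    exact Complex.re_ofReal_mul _ _

theorem reCoefₗ_apply (f : TorusL2 ν p) (ℓ : Lattice ν) (i : Fin p) :
    reCoefₗ f ℓ i = (fourierCoef f ℓ i).re := rfl

theorem reCoefₗ_neg_I_smul (f : TorusL2 ν p) (ℓ : Lattice ν) (i : Fin p) :
    reCoefₗ ((-Complex.I) • f) ℓ i = (fourierCoef f ℓ i).im := by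
  simp [reCoefₗ_apply, fourierCoef_smul]

/-- This is Re(āb) = Re a Re b + Im a Im b summed by Parseval, the imaginary part of a coefficient
of f being the real part of that of -if. It splits a complex signal into two real ones. -/
theorem re_inner_eq_reCoefₗ (f g : TorusL2 ν p) :
    (inner ℂ f g).re = inner ℝ (reCoefₗ f) (reCoefₗ g) +
      inner ℝ (reCoefₗ ((-Complex.I) • f)) (reCoefₗ ((-Complex.I) • g)) := by
  have h := Complex.reCLM.hasSum (hasSum_inner_fourierCoef f g)
  rw [Complex.reCLM_apply] at h
  refine h.unique ((((lp.hasSum_inner (reCoefₗ f) (reCoefₗ g)).add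
    (lp.hasSum_inner (reCoefₗ ((-Complex.I) • f)) (reCoefₗ ((-Complex.I) • g)))).congr_fun
      fun ℓ => ?_))
  rw [PiLp.inner_apply, PiLp.inner_apply, ← Finset.sum_add_distrib,
    Complex.reCLM_apply, Complex.re_sum]
  refine Finset.sum_congr rfl fun i _ => ?_
  rw [reCoefₗ_apply, reCoefₗ_apply, reCoefₗ_neg_I_smul, reCoefₗ_neg_I_smul]
  simp
  ring

/-- The real parts of the Fourier coefficients. -/
noncomputable def reCoef : TorusL2 ν p →L[ℝ] SqSum ν p :=
  reCoefₗ.mkContinuous 1 fun f => by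
    rw [one_mul]
    refine le_of_sq_le_sq ?_ (norm_nonneg _)
    have h := re_inner_eq_reCoefₗ f f
    rw [← RCLike.re_eq_complex_re, inner_self_eq_norm_sq, real_inner_self_eq_norm_sq,
      real_inner_self_eq_norm_sq] at h
    nlinarith [sq_nonneg ‖reCoefₗ ((-Complex.I) • f)‖]

theorem reCoef_apply (f : TorusL2 ν p) (ℓ : Lattice ν) (i : Fin p) :
    reCoef f ℓ i = (fourierCoef f ℓ i).re := rfl

theorem reCoef_neg_I_smul_apply (f : TorusL2 ν p) (ℓ : Lattice ν) (i : Fin p) :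
    reCoef ((-Complex.I) • f) ℓ i = (fourierCoef f ℓ i).im :=
  reCoefₗ_neg_I_smul f ℓ i

theorem re_inner_eq_reCoef (f g : TorusL2 ν p) :
    (inner ℂ f g).re = inner ℝ (reCoef f) (reCoef g) +
      inner ℝ (reCoef ((-Complex.I) • f)) (reCoef ((-Complex.I) • g)) :=
  re_inner_eq_reCoefₗ f g

theorem eq_of_reCoef_eq {f g : TorusL2 ν p} (h1 : reCoef f = reCoef g)
    (h2 : reCoef ((-Complex.I) • f) = reCoef ((-Complex.I) • g)) : f = g := by
  rw [← sub_eq_zero]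
  have h := re_inner_eq_reCoef (f - g) (f - g)
  rw [smul_sub, map_sub, map_sub, h1, h2, sub_self, sub_self, inner_zero_left, add_zero,
    ← RCLike.re_eq_complex_re, inner_self_eq_norm_sq] at h
  simpa using h

theorem exists_reCoef_eq (x : SqSum ν p) :
    ∃ f : TorusL2 ν p, reCoef f = x ∧ reCoef ((-Complex.I) • f) = 0 := by
  have hmem : ∀ i : Fin p, Memℓp (fun ℓ : Lattice ν => ((x ℓ i : ℝ) : ℂ)) 2 := fun i => by
    refine memℓp_gen (Summable.of_nonneg_of_le (fun _ => by positivity) (fun ℓ => ?_)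
      ((lp.memℓp x).summable (by simp)))
    simp only [ENNReal.toReal_ofNat, Real.rpow_ofNat, Complex.norm_real]
    gcongr
    exact PiLp.norm_apply_le _ i
  let g : Fin p → Lp ℂ 2 (volume : Measure (Torus ν)) := fun i =>
    (characterBasis ν).repr.symm ⟨_, hmem i⟩
  let e : Fin p → ℂ →L[ℂ] EuclideanSpace ℂ (Fin p) := fun i =>
    ContinuousLinearMap.toSpanSingleton ℂ (EuclideanSpace.single i 1)
  let f : TorusL2 ν p := ∑ i, (e i).compLpL 2 volume (g i)
  have hcomp : ∀ j, component j f = g j := by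
    intro j
    have h1 : ∀ i, component j ((e i).compLpL 2 volume (g i)) = if i = j then g i else 0 := by
      intro i
      refine Lp.ext ?_
      filter_upwards [coeFn_component j ((e i).compLpL 2 volume (g i)),
        (e i).coeFn_compLpL (p := 2) (μ := volume) (g i),
        Lp.coeFn_zero ℂ 2 (volume : Measure (Torus ν))] with σ h1 h2 h3
      rw [h1, h2]
      split_ifs with hij
      · simp [e, hij]
      · rw [h3]
        simp [e, Ne.symm hij]
    simp [f, map_sum, h1]
  have hcoef : ∀ ℓ i, fourierCoef f ℓ i = ((x ℓ i : ℝ) : ℂ) := by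
    intro ℓ i
    rw [fourierCoef, hcomp]
    simp [g]
  refine ⟨f, ?_, ?_⟩
  · ext ℓ i
    rw [reCoef_apply, hcoef, Complex.ofReal_re]
  · ext ℓ i
    rw [reCoef_neg_I_smul_apply, hcoef, Complex.ofReal_im]
    rfl

/-- The Fourier transform of a square summable function on the lattice. -/
noncomputable def fourierSeries : SqSum ν p →ₗᵢ[ℝ] TorusL2 ν p where
  toFun x := (exists_reCoef_eq x).choose
  map_add' x y := by
    refine eq_of_reCoef_eq ?_ ?_
    · simp only [map_add, (exists_reCoef_eq _).choose_spec.1]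
    · simp only [smul_add, map_add, (exists_reCoef_eq _).choose_spec.2, add_zero]
  map_smul' c x := by
    refine eq_of_reCoef_eq ?_ ?_
    · simp only [map_smul, (exists_reCoef_eq _).choose_spec.1, RingHom.id_apply]
    · simp only [smul_comm _ c, map_smul, (exists_reCoef_eq _).choose_spec.2, RingHom.id_apply,
        smul_zero]
  norm_map' x := by
    have h := re_inner_eq_reCoef (exists_reCoef_eq x).choose (exists_reCoef_eq x).choose
    rw [(exists_reCoef_eq x).choose_spec.1, (exists_reCoef_eq x).choose_spec.2, inner_zero_left,
      add_zero, ← RCLike.re_eq_complex_re, inner_self_eq_norm_sq, real_inner_self_eq_norm_sq] at h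
    exact (sq_eq_sq₀ (norm_nonneg _) (norm_nonneg _)).1 h

@[simp]
theorem reCoef_fourierSeries (x : SqSum ν p) : reCoef (fourierSeries x) = x :=
  (exists_reCoef_eq x).choose_spec.1

@[simp]
theorem reCoef_neg_I_smul_fourierSeries (x : SqSum ν p) :
    reCoef ((-Complex.I) • fourierSeries x) = 0 :=
  (exists_reCoef_eq x).choose_spec.2

/-! ### Symbols as multiplication operators -/

theorem symbol_apply (M : Lattice ν → Matrix (Fin p) (Fin q) ℝ) (σ : Torus ν) (i : Fin p)
    (l : Fin q) : symbol M σ i l = scalarSymbol (fun ℓ => M ℓ i l) σ := rfl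

theorem stronglyMeasurable_symbol (M : Lattice ν → Matrix (Fin p) (Fin q) ℝ) :
    StronglyMeasurable (symbol M) := by
  have h : symbol M = fun σ => ∑ i, ∑ l, scalarSymbol (fun ℓ => M ℓ i l) σ •
      Matrix.single i l (1 : ℂ) := by
    ext σ i l
    conv_lhs => rw [Matrix.matrix_eq_sum_single (symbol M σ)]
    simp [symbol_apply, Matrix.smul_single]
  rw [h]
  refine Finset.stronglyMeasurable_fun_sum _ fun i _ => Finset.stronglyMeasurable_fun_sum _
    fun l _ => ?_
  exact (Lp.stronglyMeasurable _).smul_const _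

theorem BoundedSymbol.memLp {M : Lattice ν → Matrix (Fin p) (Fin q) ℝ} (hM : BoundedSymbol M) :
    MemLp (symbol M) ⊤ (volume : Measure (Torus ν)) :=
  ⟨(stronglyMeasurable_symbol M).aestronglyMeasurable, by
    rw [eLpNorm_exponent_top]
    exact hM⟩

theorem norm_entry_le {m n : Type*} [Fintype m] [Fintype n] [DecidableEq m] [DecidableEq n]
    {𝕜 : Type*} [RCLike 𝕜] (M : Matrix m n 𝕜) (i : m) (l : n) : ‖M i l‖ ≤ ‖M‖ := by
  have h1 := Matrix.l2_opNorm_mulVec M (EuclideanSpace.single l 1)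
  have h2 := (PiLp.norm_apply_le ((EuclideanSpace.equiv m 𝕜).symm
    (M.mulVec (EuclideanSpace.single l (1 : 𝕜)))) i).trans h1
  simpa using h2

/-- Boundedness of the symbol puts each product of an entry with a component of f in L², so the
scalar convolution identity applies entry by entry. -/
theorem BoundedSymbol.hasSum_fourierCoef {M : Lattice ν → Matrix (Fin p) (Fin q) ℝ}
    (hM : BoundedSymbol M) (hsum : ∀ i l, Summable fun ℓ => M ℓ i l ^ 2) (f : TorusL2 ν q)
    (j : Lattice ν) (i : Fin p) :
    HasSum (fun k => ∑ l, (M (j - k) i l : ℂ) * fourierCoef f k l)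
      (fourierCoef (mulOp hM.memLp f) j i) := by
  obtain ⟨c, hc⟩ : ∃ c : ℝ, ∀ᵐ σ : Torus ν, ‖symbol M σ‖ ≤ c := by
    refine ⟨(eLpNormEssSup (symbol M) volume).toReal, ?_⟩
    have h := hM.memLp.2
    rw [eLpNorm_exponent_top] at h
    filter_upwards [enorm_ae_le_eLpNormEssSup (symbol M) (volume : Measure (Torus ν))] with σ hσ
    rw [← toReal_enorm]
    exact ENNReal.toReal_mono h.ne hσ
  have hmem : ∀ l, MemLp (fun σ => scalarSymbol (fun ℓ => M ℓ i l) σ * component l f σ) 2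
      (volume : Measure (Torus ν)) := fun l => by
    refine MemLp.of_le_mul (g := component l f) (c := c) (Lp.memLp _)
      ((Lp.aestronglyMeasurable _).mul (Lp.aestronglyMeasurable _)) ?_
    filter_upwards [hc] with σ hσ
    rw [norm_mul, ← symbol_apply M]
    gcongr
    exact (norm_entry_le _ i l).trans hσ
  have hcomp : component i (mulOp hM.memLp f) = ∑ l, (hmem l).toLp _ := by
    refine Lp.ext ?_
    filter_upwards [coeFn_component i (mulOp hM.memLp f), coeFn_mulOp hM.memLp f,
      ae_all_iff.2 fun l => coeFn_component l f, ae_all_iff.2 fun l => (hmem l).coeFn_toLp,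
      Lp.coeFn_finsetSum Finset.univ fun l => (hmem l).toLp _]
      with σ h1 h2 h3 h4 h5
    rw [h1, h2, h5, Finset.sum_apply]
    simp only [h4, h3]
    simp [symbol_apply, Matrix.toLpLin_apply, Matrix.mulVec, dotProduct]
  have := hasSum_sum (s := Finset.univ) fun l _ =>
    hasSum_repr_mul (hsum i l) (hmem l).coeFn_toLp j
  rw [fourierCoef, hcomp, map_sum, lp.coeFn_sum, Finset.sum_apply]
  exact this

/-- Under the Fourier transform, a block Toeplitz matrix acts as multiplication by its symbol. -/
theorem BoundedSymbol.toeplitz_reCoef {M : Lattice ν → Matrix (Fin p) (Fin q) ℝ}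
    (hM : BoundedSymbol M) (hsum : ∀ i l, Summable fun ℓ => M ℓ i l ^ 2) (f : TorusL2 ν q)
    (j : Lattice ν) : toeplitz M (reCoef f) j = reCoef (mulOp hM.memLp f) j := by
  have h : HasSum (fun k => Matrix.toEuclideanLin (M (j - k)) (reCoef f k))
      (reCoef (mulOp hM.memLp f) j) := by
    have h1 : HasSum (fun k (i : Fin p) => ∑ l, M (j - k) i l * (fourierCoef f k l).re)
        (fun i => (fourierCoef (mulOp hM.memLp f) j i).re) := by
      refine Pi.hasSum.2 fun i => ?_
      refine (Complex.reCLM.hasSum (hM.hasSum_fourierCoef hsum f j i)).congr_fun fun k => ?_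
      simp
    refine (h1.map (WithLp.linearEquiv 2 ℝ (Fin p → ℝ)).symm
      (PiLp.continuous_toLp 2 _)).congr_fun fun k => ?_
    ext i
    simp [Matrix.toLpLin_apply, Matrix.mulVec, dotProduct, reCoef_apply]
  exact h.tsum_eq

theorem BoundedSymbol.toeplitz_eq {M : Lattice ν → Matrix (Fin p) (Fin q) ℝ}
    (hM : BoundedSymbol M) (hsum : ∀ i l, Summable fun ℓ => M ℓ i l ^ 2) (x : SqSum ν q)
    (j : Lattice ν) : toeplitz M x j = reCoef (mulOp hM.memLp (fourierSeries x)) j := by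
  rw [← hM.toeplitz_reCoef hsum, reCoef_fourierSeries]

/-- Real matrices act separately on the real and imaginary parts of the coefficients, so signals
with real coefficients stay such. -/
theorem BoundedSymbol.reCoef_neg_I_smul_mulOp {M : Lattice ν → Matrix (Fin p) (Fin q) ℝ}
    (hM : BoundedSymbol M) (hsum : ∀ i l, Summable fun ℓ => M ℓ i l ^ 2) (x : SqSum ν q) :
    reCoef ((-Complex.I) • mulOp hM.memLp (fourierSeries x)) = 0 := by
  refine lp.ext (funext fun j => ?_)
  rw [← map_smul, ← hM.toeplitz_reCoef hsum, reCoef_neg_I_smul_fourierSeries]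
  simp [toeplitz]

end VectorFourier

/-! ### Cut-off to a measurable set of frequencies -/

section CutOff

variable {Ω : Type*} [MeasurableSpace Ω] {μ : Measure Ω} {p q n : ℕ} {S S' : Set Ω}

/-- Multiplication by the indicator function of a measurable set. -/
noncomputable def cutOff (μ : Measure Ω) (p : ℕ) (hS : MeasurableSet S) :
    Lp (EuclideanSpace ℂ (Fin p)) 2 μ →L[ℂ] Lp (EuclideanSpace ℂ (Fin p)) 2 μ :=
  mulOp ((memLp_top_const (μ := μ) (1 : Matrix (Fin p) (Fin p) ℂ)).indicator hS)

theorem coeFn_cutOff (hS : MeasurableSet S) (f : Lp (EuclideanSpace ℂ (Fin p)) 2 μ) :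
    cutOff μ p hS f =ᵐ[μ] S.indicator f := by
  filter_upwards [coeFn_mulOp ((memLp_top_const (μ := μ)
    (1 : Matrix (Fin p) (Fin p) ℂ)).indicator hS) f] with σ h
  refine h.trans ?_
  by_cases hσ : σ ∈ S <;> simp [hσ]

theorem cutOff_cutOff (hS : MeasurableSet S) (f : Lp (EuclideanSpace ℂ (Fin p)) 2 μ) :
    cutOff μ p hS (cutOff μ p hS f) = cutOff μ p hS f := by
  refine Lp.ext ?_
  filter_upwards [coeFn_cutOff hS (cutOff μ p hS f), coeFn_cutOff hS f] with σ h1 h2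
  rw [h1]
  by_cases hσ : σ ∈ S <;> simp [hσ, h2]

theorem mulOp_cutOff {M : Ω → Matrix (Fin p) (Fin q) ℂ} (hM : MemLp M ⊤ μ) (hS : MeasurableSet S)
    (f : Lp (EuclideanSpace ℂ (Fin q)) 2 μ) :
    mulOp hM (cutOff μ q hS f) = cutOff μ p hS (mulOp hM f) := by
  refine Lp.ext ?_
  filter_upwards [coeFn_cutOff hS (mulOp hM f), coeFn_cutOff hS f, coeFn_mulOp hM f,
    coeFn_mulOp hM (cutOff μ q hS f)] with σ h1 h2 h3 h4
  rw [h1, h4, h2]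
  by_cases hσ : σ ∈ S <;> simp [hσ, h3]

theorem cutOff_comm (hS : MeasurableSet S) (hS' : MeasurableSet S')
    (f : Lp (EuclideanSpace ℂ (Fin p)) 2 μ) :
    cutOff μ p hS (cutOff μ p hS' f) = cutOff μ p hS' (cutOff μ p hS f) :=
  mulOp_cutOff _ hS' f

theorem re_inner_cutOff (hS : MeasurableSet S) (f g : Lp (EuclideanSpace ℂ (Fin p)) 2 μ) :
    (inner ℂ (cutOff μ p hS f) (cutOff μ p hS g)).re = ∫ σ in S, (inner ℂ (f σ) (g σ)).re ∂μ := by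
  rw [L2.inner_def, ← RCLike.re_eq_complex_re, ← integral_re (L2.integrable_inner _ _),
    ← integral_indicator hS]
  refine integral_congr_ae ?_
  filter_upwards [coeFn_cutOff hS f, coeFn_cutOff hS g] with σ h1 h2
  rw [h1, h2]
  by_cases hσ : σ ∈ S <;> simp [hσ]

theorem norm_cutOff_le (hS : MeasurableSet S) (f : Lp (EuclideanSpace ℂ (Fin p)) 2 μ) :
    ‖cutOff μ p hS f‖ ≤ ‖f‖ := by
  refine Lp.norm_le_norm_of_ae_le ?_
  filter_upwards [coeFn_cutOff hS f] with σ h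
  rw [h]
  exact norm_indicator_le_norm_self _ _

/-- The squared error is the integral of ‖f‖² off `S k`, which vanishes in the limit by dominated
convergence; the sets need not be increasing. -/
theorem tendsto_cutOff {S : ℕ → Set Ω} (hS : ∀ k, MeasurableSet (S k))
    (h : ∀ᵐ σ ∂μ, ∀ᶠ k in atTop, σ ∈ S k) (f : Lp (EuclideanSpace ℂ (Fin p)) 2 μ) :
    Tendsto (fun k => cutOff μ p (hS k) f) atTop (𝓝 f) := by
  rw [tendsto_iff_norm_sub_tendsto_zero]
  have hsq : ∀ k, ‖cutOff μ p (hS k) f - f‖ ^ 2 = ∫ σ, ‖(S k)ᶜ.indicator f σ‖ ^ 2 ∂μ := by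
    intro k
    rw [← inner_self_eq_norm_sq (𝕜 := ℂ), L2.inner_def, ← integral_re (L2.integrable_inner _ _)]
    refine integral_congr_ae ?_
    filter_upwards [Lp.coeFn_sub (cutOff μ p (hS k) f) f, coeFn_cutOff (hS k) f] with σ h1 h2
    rw [inner_self_eq_norm_sq, h1, Pi.sub_apply, h2]
    by_cases hσ : σ ∈ S k <;> simp [hσ]
  have hlim : Tendsto (fun k => ‖cutOff μ p (hS k) f - f‖ ^ 2) atTop (𝓝 0) := by
    simp_rw [hsq]
    rw [← integral_zero Ω ℝ (μ := μ)]
    refine tendsto_integral_of_dominated_convergence (fun σ => ‖f σ‖ ^ 2) (fun k => ?_)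
      ((memLp_two_iff_integrable_sq_norm (Lp.aestronglyMeasurable f)).1 (Lp.memLp f))
      (fun k => Eventually.of_forall fun σ => ?_) ?_
    · exact ((Lp.aestronglyMeasurable f).indicator (hS k).compl).norm.pow 2
    · rw [norm_pow, norm_norm]
      gcongr
      exact norm_indicator_le_norm_self _ _
    · filter_upwards [h] with σ hσ
      refine tendsto_const_nhds.congr' ?_
      filter_upwards [hσ] with k hk
      simp [hk]
  have h2 := (Real.continuous_sqrt.tendsto _).comp hlim
  simpa [Function.comp_def, Real.sqrt_sq (norm_nonneg _)] using h2

/-- Since e ≥ 2, the substitute value -1 contracts by 1/2 at every time k ≥ 1, so it does not spoil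
the bound on the good set. -/
theorem norm_exp_smul_neg_one_le {k : ℕ} (hk : 1 ≤ k) :
    ‖NormedSpace.exp ((k : ℂ) • (-1 : Matrix (Fin n) (Fin n) ℂ))‖ ≤ 1 / 2 := by
  have h1 : ‖(1 : Matrix (Fin n) (Fin n) ℂ)‖ ≤ 1 := by
    rw [Matrix.cstar_norm_def, map_one]
    exact ContinuousLinearMap.norm_id_le
  have h2 : NormedSpace.exp ((k : ℂ) • (-1 : Matrix (Fin n) (Fin n) ℂ)) =
      Complex.exp (-k) • (1 : Matrix (Fin n) (Fin n) ℂ) := by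
    rw [smul_neg, ← neg_smul, ← Algebra.algebraMap_eq_smul_one, ← NormedSpace.algebraMap_exp_comm,
      Algebra.algebraMap_eq_smul_one, ← Complex.exp_eq_exp_ℂ]
  rw [h2, norm_smul, Complex.norm_exp]
  have h3 : Real.exp (-1) ≤ 1 / 2 := by
    rw [Real.exp_neg, one_div]
    refine inv_anti₀ (by norm_num) ?_
    linarith [Real.add_one_le_exp 1]
  have h4 : Real.exp (-(k : ℂ)).re ≤ Real.exp (-1) := by
    have : (1 : ℝ) ≤ k := by exact_mod_cast hk
    simpa using this
  calc _ ≤ 1 / 2 * 1 := mul_le_mul (h4.trans h3) h1 (norm_nonneg _) (by norm_num)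
    _ = 1 / 2 := mul_one _

/-- A matrix-valued function, replaced by `-1` off the set `S`. -/
theorem memLp_piecewise_neg_one {M : Ω → Matrix (Fin n) (Fin n) ℂ} (hM : MemLp M ⊤ μ)
    (hS : MeasurableSet S) [DecidablePred (· ∈ S)] : MemLp (S.piecewise M fun _ => -1) ⊤ μ :=
  MemLp.piecewise hS (hM.restrict S) ((memLp_top_const (-1)).restrict _)

end CutOff

/-! ### The frequency inequality at a fixed point of the torus -/

section QuadraticForm

variable {ν n m r : ℕ}

/-- The quadratic form of Z* + Z at v is 2 Re⟨v, Zv⟩. -/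
theorem posSemidef_conjTranspose_add_iff (Z : Matrix (Fin m) (Fin m) ℂ) :
    (Z.conjTranspose + Z).PosSemidef ↔
      ∀ v : EuclideanSpace ℂ (Fin m), 0 ≤ (inner ℂ v (Matrix.toEuclideanLin Z v)).re := by
  have hH : (Z.conjTranspose + Z).IsHermitian := by
    rw [Matrix.IsHermitian, Matrix.conjTranspose_add, Matrix.conjTranspose_conjTranspose, add_comm]
  have hq : ∀ x : Fin m → ℂ, star x ⬝ᵥ (Z.conjTranspose + Z).mulVec x =
      ((2 * (star x ⬝ᵥ Z.mulVec x).re : ℝ) : ℂ) := by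
    intro x
    have h1 : star x ⬝ᵥ Z.conjTranspose.mulVec x = (starRingEnd ℂ) (star x ⬝ᵥ Z.mulVec x) := by
      rw [starRingEnd_apply, ← Matrix.star_dotProduct, Matrix.star_mulVec,
        ← Matrix.dotProduct_mulVec]
    rw [Matrix.add_mulVec, dotProduct_add, h1, add_comm, Complex.add_conj]
  have hi : ∀ v : EuclideanSpace ℂ (Fin m), inner ℂ v (Matrix.toEuclideanLin Z v) =
      star v.ofLp ⬝ᵥ Z.mulVec v.ofLp := by
    intro v
    rw [EuclideanSpace.inner_eq_star_dotProduct, dotProduct_comm]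
    rfl
  rw [Matrix.posSemidef_iff_dotProduct_mulVec]
  refine ⟨fun h v => ?_, fun h => ⟨hH, fun x => ?_⟩⟩
  · have h2 := h.2 v.ofLp
    rw [hq, Complex.zero_le_real] at h2
    rw [hi]
    linarith
  · have h2 := h (WithLp.toLp 2 x)
    rw [hi] at h2
    rw [hq, Complex.zero_le_real]
    linarith

/-- By Cramer's rule the inverse is the adjugate over a determinant, which has no zero on the
imaginary axis when the symbol is Hurwitz. -/
theorem continuous_transferFunction
    (A : Lattice ν → Matrix (Fin n) (Fin n) ℝ) (B : Lattice ν → Matrix (Fin n) (Fin m) ℝ)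
    (C : Lattice ν → Matrix (Fin r) (Fin n) ℝ) (D : Lattice ν → Matrix (Fin r) (Fin m) ℝ)
    {σ : Torus ν} (hσ : IsHurwitz (symbol A σ)) :
    Continuous fun ω : ℝ => transferFunction A B C D (Complex.I * ω) σ := by
  have hinv : Continuous fun ω : ℝ =>
      ((Complex.I * ω) • (1 : Matrix (Fin n) (Fin n) ℂ) - symbol A σ)⁻¹ := by
    have hc : Continuous fun ω : ℝ =>
      ((Complex.I * ω) • (1 : Matrix (Fin n) (Fin n) ℂ) - symbol A σ) := by fun_prop
    simp_rw [Matrix.inv_def, Ring.inverse_eq_inv']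
    exact (hc.matrix_det.inv₀ fun ω => (hσ.isUnit_det ω).ne_zero).smul hc.matrix_adjugate
  unfold transferFunction
  fun_prop

/-- The real quadratic form of `𝒢(σ) F(iω, σ)`. -/
noncomputable def supplyForm
    (A : Lattice ν → Matrix (Fin n) (Fin n) ℝ) (B : Lattice ν → Matrix (Fin n) (Fin m) ℝ)
    (C : Lattice ν → Matrix (Fin r) (Fin n) ℝ) (D : Lattice ν → Matrix (Fin r) (Fin m) ℝ)
    (G : Lattice ν → Matrix (Fin m) (Fin r) ℝ) (ω : ℝ) (σ : Torus ν)
    (v : EuclideanSpace ℂ (Fin m)) : ℝ :=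
  (inner ℂ v (Matrix.toEuclideanLin
    (symbol G σ * transferFunction A B C D (Complex.I * ω) σ) v)).re

variable {A : Lattice ν → Matrix (Fin n) (Fin n) ℝ} {B : Lattice ν → Matrix (Fin n) (Fin m) ℝ}
  {C : Lattice ν → Matrix (Fin r) (Fin n) ℝ} {D : Lattice ν → Matrix (Fin r) (Fin m) ℝ}
  {G : Lattice ν → Matrix (Fin m) (Fin r) ℝ} {σ : Torus ν}

theorem continuous_supplyForm (hσ : IsHurwitz (symbol A σ)) :
    Continuous fun z : ℝ × EuclideanSpace ℂ (Fin m) => supplyForm A B C D G z.1 σ z.2 := by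
  have h1 : Continuous fun z : ℝ × EuclideanSpace ℂ (Fin m) =>
      symbol G σ * transferFunction A B C D (Complex.I * z.1) σ :=
    continuous_const.matrix_mul ((continuous_transferFunction A B C D hσ).comp continuous_fst)
  have h2 : Continuous fun z : ℝ × EuclideanSpace ℂ (Fin m) => matrixAction m m
      (symbol G σ * transferFunction A B C D (Complex.I * z.1) σ) z.2 :=
    ((matrixAction m m).continuous.comp h1).clm_apply continuous_snd
  exact Complex.continuous_re.comp (continuous_snd.inner h2)

/-- The resolvent equation forces z = (iω - 𝒜)⁻¹ℬv. This links the transfer function to the equation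
iωz - az = Bw of the operator-theoretic part. -/
theorem toEuclideanLin_transferFunction_apply (hσ : IsHurwitz (symbol A σ)) {ω : ℝ}
    {z : EuclideanSpace ℂ (Fin n)} {v : EuclideanSpace ℂ (Fin m)}
    (hz : (Complex.I * ω) • z - Matrix.toEuclideanLin (symbol A σ) z =
      Matrix.toEuclideanLin (symbol B σ) v) :
    Matrix.toEuclideanLin (symbol G σ * transferFunction A B C D (Complex.I * ω) σ) v =
      Matrix.toEuclideanLin (symbol G σ) (Matrix.toEuclideanLin (symbol C σ) z +
        Matrix.toEuclideanLin (symbol D σ) v) := by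
  have h1 : Matrix.toEuclideanLin
      ((Complex.I * ω) • (1 : Matrix (Fin n) (Fin n) ℂ) - symbol A σ) z =
      Matrix.toEuclideanLin (symbol B σ) v := by
    rw [← hz]
    simp
  have h2 : Matrix.toEuclideanLin
      ((Complex.I * ω) • (1 : Matrix (Fin n) (Fin n) ℂ) - symbol A σ)⁻¹
        (Matrix.toEuclideanLin (symbol B σ) v) = z := by
    rw [← h1, ← toEuclideanLin_mul_apply, Matrix.nonsing_inv_mul _ (hσ.isUnit_det ω)]
    simp
  rw [toEuclideanLin_mul_apply, transferFunction, map_add, LinearMap.add_apply,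
    toEuclideanLin_mul_apply, toEuclideanLin_mul_apply, h2]

end QuadraticForm

/-! ### Localization to frequencies with a uniformly stable generator -/

section Localization

variable {ν n : ℕ}

/-- The frequencies at which the semigroup generated by the symbol is a strict contraction at
time `k`. -/
def contractionSet (A : Lattice ν → Matrix (Fin n) (Fin n) ℝ) (k : ℕ) : Set (Torus ν) :=
  {σ | ‖NormedSpace.exp ((k : ℂ) • symbol A σ)‖ ≤ 1 / 2}

theorem measurableSet_contractionSet (A : Lattice ν → Matrix (Fin n) (Fin n) ℝ) (k : ℕ) :
    MeasurableSet (contractionSet A k) := by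
  let : NormedAlgebra ℚ (Matrix (Fin n) (Fin n) ℂ) := NormedAlgebra.restrictScalars ℚ ℂ _
  have h : StronglyMeasurable fun σ => ‖NormedSpace.exp ((k : ℂ) • symbol A σ)‖ :=
    (NormedSpace.exp_continuous.comp_stronglyMeasurable
      ((stronglyMeasurable_symbol A).const_smul (k : ℂ))).norm
  exact measurableSet_le h.measurable measurable_const

theorem eventually_mem_contractionSet {A : Lattice ν → Matrix (Fin n) (Fin n) ℝ} {σ : Torus ν}
    (hσ : IsHurwitz (symbol A σ)) : ∀ᶠ k in atTop, σ ∈ contractionSet A k :=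
  (hσ.tendsto_norm_exp.eventually (gt_mem_nhds (by norm_num : (0 : ℝ) < 1 / 2))).mono
    fun _ h => h.le

open Classical in
/-- The generator, replaced by `-1` off the set `contractionSet A k`. -/
noncomputable def localGenerator {A : Lattice ν → Matrix (Fin n) (Fin n) ℝ} (hA : BoundedSymbol A)
    (k : ℕ) : TorusL2 ν n →L[ℂ] TorusL2 ν n :=
  mulOp (memLp_piecewise_neg_one hA.memLp (measurableSet_contractionSet A k))

/-- The orthogonal projection onto functions supported in `contractionSet A k`. -/
noncomputable def localProjection (A : Lattice ν → Matrix (Fin n) (Fin n) ℝ) (k p : ℕ) :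
    TorusL2 ν p →L[ℂ] TorusL2 ν p :=
  cutOff volume p (measurableSet_contractionSet A k)

variable {A : Lattice ν → Matrix (Fin n) (Fin n) ℝ}

open Classical in
theorem coeFn_localGenerator (hA : BoundedSymbol A) (k : ℕ) (f : TorusL2 ν n) :
    localGenerator hA k f =ᵐ[volume] fun σ => if σ ∈ contractionSet A k then
      Matrix.toEuclideanLin (symbol A σ) (f σ) else -f σ := by
  filter_upwards [coeFn_mulOp (memLp_piecewise_neg_one hA.memLp
    (measurableSet_contractionSet A k)) f] with σ h
  refine h.trans ?_
  by_cases hσ : σ ∈ contractionSet A k <;> simp [hσ]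

theorem norm_exp_localGenerator_le (hA : BoundedSymbol A) {k : ℕ} (hk : 1 ≤ k) :
    ‖NormedSpace.exp (((k : ℝ) : ℂ) • localGenerator hA k)‖ ≤ 1 / 2 := by
  classical
  refine norm_exp_smul_mulOp_le _ _ (by norm_num) (Eventually.of_forall fun σ => ?_)
  rw [Complex.ofReal_natCast]
  by_cases hσ : σ ∈ contractionSet A k
  · rw [piecewise_eq_of_mem _ _ _ hσ]
    exact hσ
  · rw [piecewise_eq_of_notMem _ _ _ hσ]
    exact norm_exp_smul_neg_one_le hk

/-- On functions supported in the contraction set the modification is invisible, so trajectories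
supported there are the same for both generators. -/
theorem localGenerator_localProjection (hA : BoundedSymbol A) (k : ℕ) (f : TorusL2 ν n) :
    localGenerator hA k (localProjection A k n f) = mulOp hA.memLp (localProjection A k n f) := by
  classical
  refine Lp.ext ?_
  filter_upwards [coeFn_localGenerator hA k (localProjection A k n f),
    coeFn_mulOp hA.memLp (localProjection A k n f),
    coeFn_cutOff (measurableSet_contractionSet A k) f] with σ h1 h2 h3
  rw [h1, h2]
  split_ifs with hσ
  · rfl
  · have : localProjection A k n f σ = 0 := h3.trans (indicator_of_notMem hσ _)
    simp [this]

theorem localProjection_localGenerator (hA : BoundedSymbol A) (k : ℕ) (f : TorusL2 ν n) :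
    localProjection A k n (localGenerator hA k f) = localGenerator hA k (localProjection A k n f) :=
  (mulOp_cutOff _ _ f).symm

theorem localProjection_mulOp {p q : ℕ} {M : Torus ν → Matrix (Fin p) (Fin q) ℂ}
    (hM : MemLp M ⊤ volume) (k : ℕ) (f : TorusL2 ν q) :
    localProjection A k p (mulOp hM f) = mulOp hM (localProjection A k q f) :=
  (mulOp_cutOff _ _ f).symm

theorem localProjection_idem {p : ℕ} (k : ℕ) (f : TorusL2 ν p) :
    localProjection A k p (localProjection A k p f) = localProjection A k p f :=
  cutOff_cutOff _ f

end Localization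

/-! ### The two implications -/

section Equivalence

variable {ν n m r : ℕ}
  {A : Lattice ν → Matrix (Fin n) (Fin n) ℝ} {B : Lattice ν → Matrix (Fin n) (Fin m) ℝ}
  {C : Lattice ν → Matrix (Fin r) (Fin n) ℝ} {D : Lattice ν → Matrix (Fin r) (Fin m) ℝ}
  {G : Lattice ν → Matrix (Fin m) (Fin r) ℝ}

/-- A pointwise frequency inequality yields the frequency inequality for the localized
operators. -/
theorem re_inner_localized_nonneg (hA : BoundedSymbol A) (hB : BoundedSymbol B)
    (hC : BoundedSymbol C) (hD : BoundedSymbol D) (hG : BoundedSymbol G)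
    (hHurwitz : ∀ᵐ σ : Torus ν, IsHurwitz (symbol A σ))
    (hpos : ∀ᵐ σ : Torus ν, ∀ ω v, 0 ≤ supplyForm A B C D G ω σ v) (k : ℕ) (ω : ℝ)
    (z : TorusL2 ν n) (w : TorusL2 ν m)
    (hz : (Complex.I * ω) • z - localGenerator hA k z = mulOp hB.memLp (localProjection A k m w)) :
    0 ≤ (inner ℂ w (mulOp hG.memLp (mulOp hC.memLp z) +
      mulOp hG.memLp (mulOp hD.memLp (localProjection A k m w)))).re := by
  classical
  rw [L2.inner_def, ← RCLike.re_eq_complex_re, ← integral_re (L2.integrable_inner _ _)]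
  refine integral_nonneg_of_ae ?_
  filter_upwards [hHurwitz, hpos, Lp.coeFn_sub ((Complex.I * ω) • z) (localGenerator hA k z),
    Lp.coeFn_smul (Complex.I * ω) z, coeFn_localGenerator hA k z,
    coeFn_mulOp hB.memLp (localProjection A k m w),
    coeFn_cutOff (measurableSet_contractionSet A k) w,
    Lp.coeFn_add (mulOp hG.memLp (mulOp hC.memLp z))
      (mulOp hG.memLp (mulOp hD.memLp (localProjection A k m w))),
    coeFn_mulOp hG.memLp (mulOp hC.memLp z), coeFn_mulOp hC.memLp z,
    coeFn_mulOp hG.memLp (mulOp hD.memLp (localProjection A k m w)),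
    coeFn_mulOp hD.memLp (localProjection A k m w)] with
    σ hσ hp h1 h2 h3 h4 h5 h6 h7 h8 h9 h10
  have h5' : localProjection A k m w σ = (contractionSet A k).indicator w σ := h5
  rw [hz, h4, h5', Pi.sub_apply, h2, Pi.smul_apply, h3] at h1
  rw [h6, Pi.add_apply, h7, h8, h9, h10, h5', ← map_add]
  by_cases hE : σ ∈ contractionSet A k
  · rw [indicator_of_mem hE] at h1 ⊢
    rw [if_pos hE] at h1
    rw [← toEuclideanLin_transferFunction_apply hσ h1.symm]
    exact hp ω (w σ)
  -- Off the contraction set the generator is -1 and the projected input vanishes. The equation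
  -- becomes (iω + 1) z = 0, hence z = 0 and the integrand is zero.
  · rw [indicator_of_notMem hE] at h1 ⊢
    rw [if_neg hE, map_zero, sub_neg_eq_add] at h1
    have hz0 : z σ = 0 := by
      have h2 : (Complex.I * ω + 1) • z σ = 0 := by rw [add_smul, one_smul, ← h1]
      refine (smul_eq_zero.1 h2).resolve_left fun h => ?_
      simpa using congrArg Complex.re h
    simp [hz0]

/-- Evaluation at a site and the coefficient maps are continuous and linear, so they commute with
the Bochner integral. The real parts of the coefficients then reproduce the state equation site by
site; the imaginary parts vanish on both sides. -/
theorem IsTrajectory.solvesState (hA : BoundedSymbol A) (hB : BoundedSymbol B)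
    (hAs : ∀ i l, Summable fun ℓ => A ℓ i l ^ 2) (hBs : ∀ i l, Summable fun ℓ => B ℓ i l ^ 2)
    {u : ℝ → SqSum ν m} {x : ℝ → SqSum ν n} {y : ℝ → SqSum ν r}
    (h : IsTrajectory A B C D u x y) (hx : x 0 = 0) {T : ℝ}
    (hu : MemLp u 2 (volume.restrict (Icc 0 T))) :
    SolvesState (mulOp hA.memLp) (fun t => mulOp hB.memLp (fourierSeries (u t)))
      (fun t => fourierSeries (x t)) T := by
  have hc : ContinuousOn (fun t => fourierSeries (x t)) (Icc 0 T) :=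
    fourierSeries.continuous.comp_continuousOn (h.continuousOn_state.mono Icc_subset_Ici_self)
  have hi : IntegrableOn (fun t => mulOp hB.memLp (fourierSeries (u t))) (Ioc 0 T) := by
    have h1 : Integrable u (volume.restrict (Ioc 0 T)) :=
      (hu.mono_measure (Measure.restrict_mono Ioc_subset_Icc_self le_rfl)).integrable (by norm_num)
    exact (((mulOp hB.memLp).restrictScalars ℝ).comp
      fourierSeries.toContinuousLinearMap).integrable_comp h1
  refine ⟨hc, hi, fun t ht => ?_⟩
  have hInt : IntervalIntegrable (fun τ => mulOp hA.memLp (fourierSeries (x τ)) +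
      mulOp hB.memLp (fourierSeries (u τ))) volume 0 t := by
    refine IntervalIntegrable.add (ContinuousOn.intervalIntegrable ?_)
      ((intervalIntegrable_iff_integrableOn_Ioc_of_le ht.1).2
        (hi.mono_set (Ioc_subset_Ioc_right ht.2)))
    rw [uIcc_of_le ht.1]
    exact (mulOp hA.memLp).continuous.comp_continuousOn
      (hc.mono (Icc_subset_Icc_right ht.2))
  refine eq_of_reCoef_eq ?_ ?_
  · refine lp.ext (funext fun j => ?_)
    rw [reCoef_fourierSeries, h.state_eq t ht.1 j, hx]
    have h1 := ((lp.evalCLM ℝ (fun _ : Lattice ν => EuclideanSpace ℝ (Fin n)) 2 j).comp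
      reCoef).intervalIntegral_comp_comm hInt
    refine (zero_add _).trans (Eq.trans ?_ h1)
    refine intervalIntegral.integral_congr fun τ _ => ?_
    simp only [hA.toeplitz_eq hAs, hB.toeplitz_eq hBs]
    exact congrArg (fun g : SqSum ν n => g j) (map_add reCoef _ _).symm
  · rw [reCoef_neg_I_smul_fourierSeries]
    have h1 := (reCoef.comp (((-Complex.I) • ContinuousLinearMap.id ℂ
      (TorusL2 ν n)).restrictScalars ℝ)).intervalIntegral_comp_comm hInt
    refine Eq.trans ?_ h1
    symm
    refine (intervalIntegral.integral_congr (g := fun _ => 0) fun τ _ => ?_).trans (by simp)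
    change reCoef ((-Complex.I) • (_ + _)) = 0
    rw [smul_add, map_add, hA.reCoef_neg_I_smul_mulOp hAs, hB.reCoef_neg_I_smul_mulOp hBs,
      add_zero]

/-- Parseval, with no contribution from imaginary parts because the input has real Fourier
coefficients. -/
theorem IsTrajectory.supplyRate_eq (hC : BoundedSymbol C) (hD : BoundedSymbol D)
    (hG : BoundedSymbol G)
    (hCs : ∀ i l, Summable fun ℓ => C ℓ i l ^ 2) (hDs : ∀ i l, Summable fun ℓ => D ℓ i l ^ 2)
    (hGs : ∀ i l, Summable fun ℓ => G ℓ i l ^ 2)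
    {u : ℝ → SqSum ν m} {x : ℝ → SqSum ν n} {y : ℝ → SqSum ν r}
    (h : IsTrajectory A B C D u x y) {t : ℝ} (ht : 0 ≤ t) :
    supplyRate G (u t) (y t) = (inner ℂ (fourierSeries (u t))
      (mulOp hG.memLp (mulOp hC.memLp (fourierSeries (x t))) +
        mulOp hG.memLp (mulOp hD.memLp (fourierSeries (u t))))).re := by
  have hy : fourierSeries (y t) = mulOp hC.memLp (fourierSeries (x t)) +
      mulOp hD.memLp (fourierSeries (u t)) := by
    refine eq_of_reCoef_eq (lp.ext (funext fun j => ?_)) ?_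
    · rw [reCoef_fourierSeries, h.output_eq t ht j, hC.toeplitz_eq hCs, hD.toeplitz_eq hDs,
        map_add]
      rfl
    · rw [reCoef_neg_I_smul_fourierSeries, smul_add, map_add, hC.reCoef_neg_I_smul_mulOp hCs,
        hD.reCoef_neg_I_smul_mulOp hDs, add_zero]
  rw [← map_add, ← hy, re_inner_eq_reCoef, reCoef_fourierSeries, reCoef_neg_I_smul_fourierSeries,
    inner_zero_left, add_zero, lp.inner_eq_tsum]
  simp only [supplyRate, hG.toeplitz_eq hGs]

/-- The cut-off trajectory solves the equation of the localized generator, which contracts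
uniformly, so its work is nonnegative. As k grows the cut-offs converge to the identity strongly,
and domination by the full signals gives the limit. -/
theorem isPassive_of_supplyForm_nonneg (hA : BoundedSymbol A) (hB : BoundedSymbol B)
    (hC : BoundedSymbol C) (hD : BoundedSymbol D) (hG : BoundedSymbol G)
    (hAs : ∀ i l, Summable fun ℓ => A ℓ i l ^ 2) (hBs : ∀ i l, Summable fun ℓ => B ℓ i l ^ 2)
    (hCs : ∀ i l, Summable fun ℓ => C ℓ i l ^ 2) (hDs : ∀ i l, Summable fun ℓ => D ℓ i l ^ 2)
    (hGs : ∀ i l, Summable fun ℓ => G ℓ i l ^ 2)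
    (hHurwitz : ∀ᵐ σ : Torus ν, IsHurwitz (symbol A σ))
    (hpos : ∀ᵐ σ : Torus ν, ∀ ω v, 0 ≤ supplyForm A B C D G ω σ v) : IsPassive A B C D G := by
  intro u hu x y h hx T hT
  set U : ℝ → TorusL2 ν m := fun t => fourierSeries (u t) with hUdef
  set X : ℝ → TorusL2 ν n := fun t => fourierSeries (x t) with hXdef
  set β := mulOp hB.memLp
  set H := (mulOp hG.memLp).comp (mulOp hC.memLp) with hH
  set J := (mulOp hG.memLp).comp (mulOp hD.memLp) with hJ
  have hsol : SolvesState (mulOp hA.memLp) (fun t => β (U t)) X T :=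
    h.solvesState hA hB hAs hBs hx (hu T hT)
  have hU : MemLp U 2 (volume.restrict (Ioc 0 T)) :=
    fourierSeries.toContinuousLinearMap.comp_memLp'
      ((hu T hT).mono_measure (Measure.restrict_mono Ioc_subset_Icc_self le_rfl))
  have hrate : ∫ t in (0 : ℝ)..T, supplyRate G (u t) (y t) =
      ∫ t in (0 : ℝ)..T, (inner ℂ (U t) (H (X t) + J (U t))).re := by
    refine intervalIntegral.integral_congr fun t ht => ?_
    rw [uIcc_of_le hT.le] at ht
    exact h.supplyRate_eq hC hD hG hCs hDs hGs ht.1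
  rw [hrate]
  have hloc : ∀ k : ℕ, 1 ≤ k → 0 ≤ ∫ t in (0 : ℝ)..T, (inner ℂ (localProjection A k m (U t))
      (H (localProjection A k n (X t)) + J (localProjection A k m (U t)))).re := by
    intro k hk
    have hexp := norm_exp_localGenerator_le hA hk
    -- The projection is built into `B` and `J` so that the frequency inequality can be verified for
    -- every w; by idempotence it changes nothing on the projected input.
    have h1 := supply_nonneg_of_frequency (a := localGenerator hA k)
      (B := β.comp (localProjection A k m)) (H := H) (J := J.comp (localProjection A k m))
      (τ := k) (by exact_mod_cast hk) hexp
      (fun ω z w hz => re_inner_localized_nonneg hA hB hC hD hG hHurwitz hpos k ω z w hz) hT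
      (U := fun t => localProjection A k m (U t)) (X := fun t => localProjection A k n (X t))
      ((localProjection A k m).comp_memLp' hU) ?_
    · simpa only [ContinuousLinearMap.comp_apply, localProjection_idem] using h1
    · simp only [ContinuousLinearMap.comp_apply, localProjection_idem]
      refine ⟨(localProjection A k n).continuous.comp_continuousOn hsol.continuousOn, ?_, ?_⟩
      · have h2 := (localProjection A k n).integrable_comp hsol.integrableOn
        refine h2.congr (Eventually.of_forall fun t => ?_)
        exact localProjection_mulOp hB.memLp k (U t)
      · intro t ht
        rw [hsol.eq_integral t ht]
        refine ((localProjection A k n).intervalIntegral_comp_comm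
          ((hsol.intervalIntegrable_state ht).add (hsol.intervalIntegrable_input ht))).symm.trans ?_
        refine intervalIntegral.integral_congr fun τ _ => ?_
        simp only [map_add]
        rw [localGenerator_localProjection, localProjection_mulOp, localProjection_mulOp]
  have hXm : MemLp X 2 (volume.restrict (Ioc 0 T)) := hsol.memLp
  have hlim : Tendsto (fun k : ℕ => ∫ t in (0 : ℝ)..T, (inner ℂ (localProjection A k m (U t))
      (H (localProjection A k n (X t)) + J (localProjection A k m (U t)))).re) atTop
      (𝓝 (∫ t in (0 : ℝ)..T, (inner ℂ (U t) (H (X t) + J (U t))).re)) := by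
    have hae : ∀ᵐ σ : Torus ν, ∀ᶠ k in atTop, σ ∈ contractionSet A k :=
      hHurwitz.mono fun σ hσ => eventually_mem_contractionSet hσ
    have htend : ∀ (p : ℕ) (f : TorusL2 ν p),
        Tendsto (fun k => localProjection A k p f) atTop (𝓝 f) := fun p f =>
      tendsto_cutOff (measurableSet_contractionSet A) hae f
    refine intervalIntegral.tendsto_integral_filter_of_dominated_convergence
      (fun t => ‖U t‖ * (‖H‖ * ‖X t‖ + ‖J‖ * ‖U t‖)) (Eventually.of_forall fun k => ?_)
      (Eventually.of_forall fun k => Eventually.of_forall fun t _ => ?_) ?_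
      (Eventually.of_forall fun t _ => ?_)
    · rw [uIoc_of_le hT.le]
      have h1 := (localProjection A k m).continuous.comp_aestronglyMeasurable
        hU.aestronglyMeasurable
      have h2 := (localProjection A k n).continuous.comp_aestronglyMeasurable
        hXm.aestronglyMeasurable
      exact Complex.continuous_re.comp_aestronglyMeasurable
        (h1.inner ((H.continuous.comp_aestronglyMeasurable h2).add
          (J.continuous.comp_aestronglyMeasurable h1)))
    · refine (Complex.abs_re_le_norm _).trans ((norm_inner_le_norm _ _).trans ?_)
      have h1 : ∀ (p : ℕ) (f : TorusL2 ν p), ‖localProjection A k p f‖ ≤ ‖f‖ := fun p f =>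
        norm_cutOff_le _ f
      gcongr
      · exact h1 m _
      · refine (norm_add_le _ _).trans (add_le_add ?_ ?_)
        · exact (H.le_opNorm _).trans (by gcongr; exact h1 n _)
        · exact (J.le_opNorm _).trans (by gcongr; exact h1 m _)
    · rw [intervalIntegrable_iff_integrableOn_Ioc_of_le hT.le]
      exact MemLp.integrable_mul hU.norm ((hXm.norm.const_mul _).add (hU.norm.const_mul _))
    · refine (Complex.continuous_re.tendsto _).comp ((htend m _).inner (Tendsto.add ?_ ?_))
      · exact (H.continuous.tendsto _).comp (htend n _)
      · exact (J.continuous.tendsto _).comp (htend m _)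
  refine ge_of_tendsto hlim ?_
  filter_upwards [eventually_ge_atTop 1] with k hk
  exact hloc k hk

end Equivalence

/-! ### From passivity to the frequency inequality -/

section Converse

variable {ν n m r : ℕ}
  {A : Lattice ν → Matrix (Fin n) (Fin n) ℝ} {B : Lattice ν → Matrix (Fin n) (Fin m) ℝ}
  {C : Lattice ν → Matrix (Fin r) (Fin n) ℝ} {D : Lattice ν → Matrix (Fin r) (Fin m) ℝ}
  {G : Lattice ν → Matrix (Fin m) (Fin r) ℝ}

/-- The real parts of the Fourier coefficients of a trajectory in frequency space form a
trajectory of the network. -/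
theorem isTrajectory_reCoef (hA : BoundedSymbol A) (hB : BoundedSymbol B)
    (hC : BoundedSymbol C) (hD : BoundedSymbol D)
    (hAs : ∀ i l, Summable fun ℓ => A ℓ i l ^ 2) (hBs : ∀ i l, Summable fun ℓ => B ℓ i l ^ 2)
    (hCs : ∀ i l, Summable fun ℓ => C ℓ i l ^ 2) (hDs : ∀ i l, Summable fun ℓ => D ℓ i l ^ 2)
    {U : ℝ → TorusL2 ν m} {X : ℝ → TorusL2 ν n} (hU : Continuous U) (hX : Continuous X)
    (hsol : ∀ t, 0 ≤ t →
      X t = ∫ τ in (0 : ℝ)..t, (mulOp hA.memLp (X τ) + mulOp hB.memLp (U τ))) :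
    IsTrajectory A B C D (fun t => reCoef (U t)) (fun t => reCoef (X t))
      (fun t => reCoef (mulOp hC.memLp (X t) + mulOp hD.memLp (U t))) where
  continuousOn_state := (reCoef.continuous.comp hX).continuousOn
  state_eq t ht j := by
    have h0 : X 0 = 0 := by rw [hsol 0 le_rfl]; simp
    have hInt : IntervalIntegrable (fun τ => mulOp hA.memLp (X τ) + mulOp hB.memLp (U τ))
        volume 0 t := Continuous.intervalIntegrable (by fun_prop) _ _
    have h1 := ((lp.evalCLM ℝ (fun _ : Lattice ν => EuclideanSpace ℝ (Fin n)) 2 j).comp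
      reCoef).intervalIntegral_comp_comm hInt
    rw [← hsol t ht] at h1
    rw [h0, map_zero]
    refine Eq.trans h1.symm (Eq.trans ?_ (zero_add _).symm)
    refine intervalIntegral.integral_congr fun τ _ => ?_
    simp only [hA.toeplitz_reCoef hAs, hB.toeplitz_reCoef hBs]
    exact congrArg (fun g : SqSum ν n => g j) (map_add reCoef _ _)
  output_eq t _ j := by
    rw [hC.toeplitz_reCoef hCs, hD.toeplitz_reCoef hDs, map_add]
    rfl

theorem supplyRate_reCoef (hG : BoundedSymbol G) (hGs : ∀ i l, Summable fun ℓ => G ℓ i l ^ 2)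
    (f : TorusL2 ν m) (g : TorusL2 ν r) :
    supplyRate G (reCoef f) (reCoef g) = inner ℝ (reCoef f) (reCoef (mulOp hG.memLp g)) := by
  simp only [supplyRate, hG.toeplitz_reCoef hGs, lp.inner_eq_tsum]

theorem locallySquareIntegrable_of_continuous {u : ℝ → SqSum ν m} (hu : Continuous u) :
    LocallySquareIntegrable u := fun T _ => by
  obtain ⟨c, hc⟩ := isCompact_Icc.exists_bound_of_continuousOn (s := Icc 0 T) hu.continuousOn
  refine MemLp.of_bound hu.aestronglyMeasurable c ?_
  filter_upwards [ae_restrict_mem measurableSet_Icc] with t ht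
  exact hc t ht

/-- Passivity for complex inputs. -/
theorem IsPassive.integral_re_inner_nonneg (h : IsPassive A B C D G)
    (hA : BoundedSymbol A) (hB : BoundedSymbol B)
    (hC : BoundedSymbol C) (hD : BoundedSymbol D) (hG : BoundedSymbol G)
    (hAs : ∀ i l, Summable fun ℓ => A ℓ i l ^ 2) (hBs : ∀ i l, Summable fun ℓ => B ℓ i l ^ 2)
    (hCs : ∀ i l, Summable fun ℓ => C ℓ i l ^ 2) (hDs : ∀ i l, Summable fun ℓ => D ℓ i l ^ 2)
    (hGs : ∀ i l, Summable fun ℓ => G ℓ i l ^ 2)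
    {U : ℝ → TorusL2 ν m} {X : ℝ → TorusL2 ν n} (hU : Continuous U) (hX : Continuous X)
    (hsol : ∀ t, 0 ≤ t →
      X t = ∫ τ in (0 : ℝ)..t, (mulOp hA.memLp (X τ) + mulOp hB.memLp (U τ))) {T : ℝ}
    (hT : 0 < T) :
    0 ≤ ∫ t in (0 : ℝ)..T, (inner ℂ (U t)
      (mulOp hG.memLp (mulOp hC.memLp (X t) + mulOp hD.memLp (U t)))).re := by
  -- Passivity for the real parts of cU: c = 1 gives the real parts of the coefficients of U, and c
  -- = -i the imaginary parts.
  have key : ∀ c : ℂ, 0 ≤ ∫ t in (0 : ℝ)..T, inner ℝ (reCoef (c • U t)) (reCoef (c •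
      mulOp hG.memLp (mulOp hC.memLp (X t) + mulOp hD.memLp (U t)))) := by
    intro c
    have hsol' : ∀ t, 0 ≤ t → c • X t =
        ∫ τ in (0 : ℝ)..t, (mulOp hA.memLp (c • X τ) + mulOp hB.memLp (c • U τ)) := by
      intro t ht
      rw [hsol t ht, ← intervalIntegral.integral_smul]
      simp only [map_smul, smul_add]
    have h0 : X 0 = 0 := by rw [hsol 0 le_rfl]; simp
    have h1 := h _ (locallySquareIntegrable_of_continuous
      (reCoef.continuous.comp (hU.const_smul c))) _ _
      (isTrajectory_reCoef hA hB hC hD hAs hBs hCs hDs (hU.const_smul c) (hX.const_smul c) hsol')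
      (by simp [h0]) T hT
    simpa only [Function.comp_apply, Pi.smul_apply, supplyRate_reCoef hG hGs, map_smul,
      ← smul_add] using h1
  simp_rw [re_inner_eq_reCoef]
  rw [intervalIntegral.integral_add (Continuous.intervalIntegrable (by fun_prop) _ _)
    (Continuous.intervalIntegrable (by fun_prop) _ _)]
  refine add_nonneg ?_ (key (-Complex.I))
  simpa using key 1

/-- For w supported in the contraction set, z and its free evolution are supported there too. The
harmonic response of the localized generator is therefore a genuine response of the network from
rest, to which passivity applies for every T. -/
theorem IsPassive.re_inner_localized_nonneg (h : IsPassive A B C D G)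
    (hA : BoundedSymbol A) (hB : BoundedSymbol B)
    (hC : BoundedSymbol C) (hD : BoundedSymbol D) (hG : BoundedSymbol G)
    (hAs : ∀ i l, Summable fun ℓ => A ℓ i l ^ 2) (hBs : ∀ i l, Summable fun ℓ => B ℓ i l ^ 2)
    (hCs : ∀ i l, Summable fun ℓ => C ℓ i l ^ 2) (hDs : ∀ i l, Summable fun ℓ => D ℓ i l ^ 2)
    (hGs : ∀ i l, Summable fun ℓ => G ℓ i l ^ 2) {k : ℕ} (hk : 1 ≤ k) {ω : ℝ}
    {z : TorusL2 ν n} {w : TorusL2 ν m} (hw : localProjection A k m w = w)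
    (hz : (Complex.I * ω) • z - localGenerator hA k z = mulOp hB.memLp w) :
    0 ≤ (inner ℂ w (mulOp hG.memLp (mulOp hC.memLp z + mulOp hD.memLp w))).re := by
  have hexp := norm_exp_localGenerator_le hA hk
  -- Both sides solve the same resolvent equation, because the projection commutes with the
  -- generator and fixes w.
  have hzP : localProjection A k n z = z := by
    refine (bijective_resolvent (localGenerator hA k) hexp ω).1 ?_
    simp only
    rw [← localProjection_localGenerator, ← map_smul, ← map_sub, hz, localProjection_mulOp, hw]
  have hexpP : ∀ t : ℝ, localProjection A k n (NormedSpace.exp ((t : ℂ) • localGenerator hA k) z) =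
      NormedSpace.exp ((t : ℂ) • localGenerator hA k) z := by
    intro t
    have hc : Commute (localProjection A k n) (localGenerator hA k) :=
      ContinuousLinearMap.ext fun f => localProjection_localGenerator hA k f
    have h1 := congrArg (fun g : TorusL2 ν n →L[ℂ] TorusL2 ν n => g z)
      ((hc.smul_right (t : ℂ)).exp_right).eq
    refine Eq.trans h1 ?_
    exact congrArg (NormedSpace.exp ((t : ℂ) • localGenerator hA k) :
      TorusL2 ν n →L[ℂ] TorusL2 ν n) hzP
  set X : ℝ → TorusL2 ν n := fun t => Complex.exp (Complex.I * ω * t) • z -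
    NormedSpace.exp ((t : ℂ) • localGenerator hA k) z with hXdef
  have hXP : ∀ t, localProjection A k n (X t) = X t := fun t => by
    rw [hXdef, map_sub, map_smul, hzP, hexpP]
  have hAX : ∀ t, localGenerator hA k (X t) = mulOp hA.memLp (X t) := fun t => by
    rw [← hXP t, localGenerator_localProjection]
  have hXc : Continuous X := by
    have : Continuous fun t : ℝ => NormedSpace.exp ((t : ℂ) • localGenerator hA k) z :=
      continuous_iff_continuousAt.2 fun t => (hasDerivAt_exp_ofReal_smul_apply _ z t).continuousAt
    fun_prop
  have hsol : ∀ t, 0 ≤ t → X t = ∫ τ in (0 : ℝ)..t, (mulOp hA.memLp (X τ) +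
      mulOp hB.memLp (Complex.exp (Complex.I * ω * τ) • w)) := by
    intro t ht
    have h1 := (solvesState_harmonic (localGenerator hA k) {()} (fun _ => ω) (fun _ => z)
      (fun _ => mulOp hB.memLp w) (fun _ _ => hz) t).eq_integral t ⟨ht, le_rfl⟩
    simp only [Finset.sum_singleton] at h1
    refine h1.trans (intervalIntegral.integral_congr fun τ _ => ?_)
    simp only [map_smul]
    rw [← hAX]
  have hres := frequency_nonneg_of_supply (a := localGenerator hA k)
    (H := (mulOp hG.memLp).comp (mulOp hC.memLp)) (J := (mulOp hG.memLp).comp (mulOp hD.memLp))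
    (τ := k) (by exact_mod_cast hk) hexp (ω := ω) (z := z) (w := w) fun T hT => ?_
  · simpa only [ContinuousLinearMap.comp_apply, ← map_add] using hres
  · simp only [ContinuousLinearMap.comp_apply, ← map_add]
    exact h.integral_re_inner_nonneg hA hB hC hD hG hAs hBs hCs hDs hGs
      (U := fun t => Complex.exp (Complex.I * ω * t) • w) (X := X) (by fun_prop) hXc hsol hT

/-- Take w to be the constant v on the contraction set. Cutting w off to any measurable S cuts off z
and the output alike, so the integral of the form over every S is nonnegative and the form itself is
nonnegative almost everywhere. -/
theorem IsPassive.ae_supplyForm_nonneg_of_mem (h : IsPassive A B C D G)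
    (hA : BoundedSymbol A) (hB : BoundedSymbol B)
    (hC : BoundedSymbol C) (hD : BoundedSymbol D) (hG : BoundedSymbol G)
    (hAs : ∀ i l, Summable fun ℓ => A ℓ i l ^ 2) (hBs : ∀ i l, Summable fun ℓ => B ℓ i l ^ 2)
    (hCs : ∀ i l, Summable fun ℓ => C ℓ i l ^ 2) (hDs : ∀ i l, Summable fun ℓ => D ℓ i l ^ 2)
    (hGs : ∀ i l, Summable fun ℓ => G ℓ i l ^ 2)
    (hHurwitz : ∀ᵐ σ : Torus ν, IsHurwitz (symbol A σ)) {k : ℕ} (hk : 1 ≤ k) (ω : ℝ)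
    (v : EuclideanSpace ℂ (Fin m)) :
    ∀ᵐ σ : Torus ν, σ ∈ contractionSet A k → 0 ≤ supplyForm A B C D G ω σ v := by
  classical
  have hv : MemLp (fun _ : Torus ν => v) 2 volume := memLp_const v
  set w : TorusL2 ν m := localProjection A k m (hv.toLp _) with hw
  obtain ⟨z, hz⟩ := (bijective_resolvent (localGenerator hA k)
    (norm_exp_localGenerator_le hA hk) ω).2 (mulOp hB.memLp w)
  simp only at hz
  set g : TorusL2 ν m := mulOp hG.memLp (mulOp hC.memLp z + mulOp hD.memLp w) with hg
  have hnonneg : 0 ≤ᵐ[volume] fun σ : Torus ν => (inner ℂ (w σ) (g σ)).re := by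
    refine ae_nonneg_of_forall_setIntegral_nonneg (L2.integrable_inner (𝕜 := ℂ) w g).re
      fun S hS _ => ?_
    rw [← re_inner_cutOff hS, hg, ← mulOp_cutOff, map_add, ← mulOp_cutOff, ← mulOp_cutOff]
    refine h.re_inner_localized_nonneg hA hB hC hD hG hAs hBs hCs hDs hGs hk (ω := ω) ?_ ?_
    · refine (cutOff_comm _ hS w).trans ?_
      exact congrArg _ (localProjection_idem k _)
    · rw [mulOp_cutOff, ← hz, map_sub, map_smul]
      congr 1
      exact mulOp_cutOff _ hS z
  filter_upwards [hnonneg, hHurwitz, hv.coeFn_toLp,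
    coeFn_cutOff (measurableSet_contractionSet A k) (hv.toLp _),
    Lp.coeFn_sub ((Complex.I * ω) • z) (localGenerator hA k z), Lp.coeFn_smul (Complex.I * ω) z,
    coeFn_localGenerator hA k z, coeFn_mulOp hB.memLp w,
    coeFn_mulOp hG.memLp (mulOp hC.memLp z + mulOp hD.memLp w),
    Lp.coeFn_add (mulOp hC.memLp z) (mulOp hD.memLp w), coeFn_mulOp hC.memLp z,
    coeFn_mulOp hD.memLp w] with σ h0 hσ h1 h2 h3 h4 h5 h6 h7 h8 h9 h10 hE
  have hwσ : w σ = v := (h2.trans (indicator_of_mem hE _)).trans h1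
  rw [hz, h6, Pi.sub_apply, h4, Pi.smul_apply, h5, if_pos hE, hwσ] at h3
  rw [Pi.zero_apply, hg, h7, h8, Pi.add_apply, h9, h10, hwσ,
    ← toEuclideanLin_transferFunction_apply hσ h3.symm] at h0
  exact h0

/-- The exceptional null set depends on k, ω and v, so only countably many choices are made; joint
continuity of the form in (ω, v) covers the rest. -/
theorem IsPassive.ae_supplyForm_nonneg (h : IsPassive A B C D G)
    (hA : BoundedSymbol A) (hB : BoundedSymbol B)
    (hC : BoundedSymbol C) (hD : BoundedSymbol D) (hG : BoundedSymbol G)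
    (hAs : ∀ i l, Summable fun ℓ => A ℓ i l ^ 2) (hBs : ∀ i l, Summable fun ℓ => B ℓ i l ^ 2)
    (hCs : ∀ i l, Summable fun ℓ => C ℓ i l ^ 2) (hDs : ∀ i l, Summable fun ℓ => D ℓ i l ^ 2)
    (hGs : ∀ i l, Summable fun ℓ => G ℓ i l ^ 2)
    (hHurwitz : ∀ᵐ σ : Torus ν, IsHurwitz (symbol A σ)) :
    ∀ᵐ σ : Torus ν, ∀ ω v, 0 ≤ supplyForm A B C D G ω σ v := by
  let d : ℕ → ℝ × EuclideanSpace ℂ (Fin m) := TopologicalSpace.denseSeq _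
  have hall : ∀ᵐ σ : Torus ν, ∀ k : ℕ, 1 ≤ k → ∀ i, σ ∈ contractionSet A k →
      0 ≤ supplyForm A B C D G (d i).1 σ (d i).2 := by
    refine ae_all_iff.2 fun k => eventually_imp_distrib_left.2 fun hk => ae_all_iff.2 fun i => ?_
    exact h.ae_supplyForm_nonneg_of_mem hA hB hC hD hG hAs hBs hCs hDs hGs hHurwitz hk _ _
  filter_upwards [hall, hHurwitz] with σ h1 hσ ω v
  obtain ⟨k, hkE, hk⟩ := ((eventually_mem_contractionSet hσ).and (eventually_ge_atTop 1)).exists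
  have hclosed : IsClosed {z : ℝ × EuclideanSpace ℂ (Fin m) |
      0 ≤ supplyForm A B C D G z.1 σ z.2} :=
    isClosed_le continuous_const (continuous_supplyForm hσ)
  have hdense : Dense {z : ℝ × EuclideanSpace ℂ (Fin m) |
      0 ≤ supplyForm A B C D G z.1 σ z.2} := by
    refine (TopologicalSpace.denseRange_denseSeq _).mono ?_
    rintro _ ⟨i, rfl⟩
    exact h1 k hk i hkE
  have hmem : (ω, v) ∈ {z : ℝ × EuclideanSpace ℂ (Fin m) |
      0 ≤ supplyForm A B C D G z.1 σ z.2} := by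
    rw [← hclosed.closure_eq, hdense.closure_eq]
    trivial
  exact hmem

/-! ### Semidefiniteness and the almost-everywhere quantifiers -/

theorem posSemidef_iff_supplyForm_nonneg (ω : ℝ) (σ : Torus ν) :
    ((transferFunction A B C D (Complex.I * ω) σ).conjTranspose * (symbol G σ).conjTranspose +
        symbol G σ * transferFunction A B C D (Complex.I * ω) σ).PosSemidef ↔
      ∀ v, 0 ≤ supplyForm A B C D G ω σ v := by
  rw [← Matrix.conjTranspose_mul, posSemidef_conjTranspose_add_iff]
  rfl

/-- A set of full Lebesgue measure is dense, and by continuity in ω the set where the form is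
nonnegative is closed. -/
theorem supplyForm_nonneg_of_ae {σ : Torus ν} (hσ : IsHurwitz (symbol A σ))
    (h : ∀ᵐ ω : ℝ, ∀ v, 0 ≤ supplyForm A B C D G ω σ v) (ω : ℝ)
    (v : EuclideanSpace ℂ (Fin m)) : 0 ≤ supplyForm A B C D G ω σ v := by
  have hc : Continuous fun ω : ℝ => supplyForm A B C D G ω σ v := by
    have h1 : Continuous fun z : ℝ × EuclideanSpace ℂ (Fin m) =>
      supplyForm A B C D G z.1 σ z.2 := continuous_supplyForm hσ
    have h2 : Continuous fun ω : ℝ => (ω, v) := by fun_prop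
    have h3 := h1.comp h2
    exact h3
  have hclosed : IsClosed {ω : ℝ | 0 ≤ supplyForm A B C D G ω σ v} :=
    isClosed_le continuous_const hc
  have hdense : Dense {ω : ℝ | 0 ≤ supplyForm A B C D G ω σ v} :=
    Measure.dense_of_ae (h.mono fun ω hω => hω v)
  have hmem : ω ∈ {ω : ℝ | 0 ≤ supplyForm A B C D G ω σ v} := by
    rw [← hclosed.closure_eq, hdense.closure_eq]
    trivial
  exact hmem

/-- Almost everywhere on `ℝ × 𝕋^ν` amounts to all `ω` at almost every point of the torus, by
continuity in `ω`. -/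
theorem ae_posSemidef_iff (hHurwitz : ∀ᵐ σ : Torus ν, IsHurwitz (symbol A σ)) :
    (∀ᵐ p : ℝ × Torus ν,
        ((transferFunction A B C D (Complex.I * p.1) p.2).conjTranspose *
            (symbol G p.2).conjTranspose +
          symbol G p.2 * transferFunction A B C D (Complex.I * p.1) p.2).PosSemidef) ↔
      ∀ᵐ σ : Torus ν, ∀ ω v, 0 ≤ supplyForm A B C D G ω σ v := by
  simp_rw [posSemidef_iff_supplyForm_nonneg]
  constructor
  · intro h
    -- The factors are swapped so that Fubini puts the quantifier over σ outermost.
    have h1 : ∀ᵐ p : Torus ν × ℝ, ∀ v, 0 ≤ supplyForm A B C D G p.2 p.1 v :=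
      (Measure.measurePreserving_swap (μ := (volume : Measure (Torus ν)))
        (ν := (volume : Measure ℝ))).quasiMeasurePreserving.ae h
    filter_upwards [Measure.ae_ae_of_ae_prod h1, hHurwitz] with σ h2 hσ
    exact supplyForm_nonneg_of_ae hσ h2
  · intro h
    have h1 := (Measure.quasiMeasurePreserving_snd (μ := (volume : Measure ℝ))
      (ν := (volume : Measure (Torus ν)))).ae h
    exact h1.mono fun p hp v => hp p.1 v

theorem summable_sq_entry {I J : Type*} [Fintype I] [Fintype J] [DecidableEq I] [DecidableEq J]
    {M : Lattice ν → Matrix I J ℝ} (hM : Summable fun ℓ => ‖M ℓ‖ ^ 2) (i : I) (j : J) :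
    Summable fun ℓ => M ℓ i j ^ 2 := by
  refine Summable.of_nonneg_of_le (fun _ => sq_nonneg _) (fun ℓ => ?_) hM
  rw [← sq_abs, ← Real.norm_eq_abs]
  gcongr
  exact norm_entry_le _ i j

end Converse

end LatticeNetwork

theorem theorem2 {ν n m r : ℕ}
    (A : Lattice ν → Matrix (Fin n) (Fin n) ℝ) (B : Lattice ν → Matrix (Fin n) (Fin m) ℝ)
    (C : Lattice ν → Matrix (Fin r) (Fin n) ℝ) (D : Lattice ν → Matrix (Fin r) (Fin m) ℝ)
    (G : Lattice ν → Matrix (Fin m) (Fin r) ℝ)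
    (hABCD : Summable fun ℓ => ‖Matrix.fromBlocks (A ℓ) (B ℓ) (C ℓ) (D ℓ)‖ ^ 2)
    (hA : BoundedSymbol A) (hB : BoundedSymbol B) (hC : BoundedSymbol C) (hD : BoundedSymbol D)
    (hGsum : Summable fun ℓ => ‖G ℓ‖ ^ 2) (hG : BoundedSymbol G)
    (hHurwitz : ∀ᵐ σ : Torus ν, IsHurwitz (symbol A σ)) :
    IsPassive A B C D G ↔
      ∀ᵐ p : ℝ × Torus ν,
        ((transferFunction A B C D (Complex.I * p.1) p.2).conjTranspose *
            (symbol G p.2).conjTranspose +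
          symbol G p.2 * transferFunction A B C D (Complex.I * p.1) p.2).PosSemidef := by
  have hAs : ∀ i l, Summable fun ℓ => A ℓ i l ^ 2 := fun i l =>
    summable_sq_entry hABCD (Sum.inl i) (Sum.inl l)
  have hBs : ∀ i l, Summable fun ℓ => B ℓ i l ^ 2 := fun i l =>
    summable_sq_entry hABCD (Sum.inl i) (Sum.inr l)
  have hCs : ∀ i l, Summable fun ℓ => C ℓ i l ^ 2 := fun i l =>
    summable_sq_entry hABCD (Sum.inr i) (Sum.inl l)
  have hDs : ∀ i l, Summable fun ℓ => D ℓ i l ^ 2 := fun i l =>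
    summable_sq_entry hABCD (Sum.inr i) (Sum.inr l)
  have hGs : ∀ i l, Summable fun ℓ => G ℓ i l ^ 2 := summable_sq_entry hGsum
  rw [ae_posSemidef_iff hHurwitz]
  exact ⟨fun h => h.ae_supplyForm_nonneg hA hB hC hD hG hAs hBs hCs hDs hGs hHurwitz,
    isPassive_of_supplyForm_nonneg hA hB hC hD hG hAs hBs hCs hDs hGs hHurwitz⟩
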